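/- Let $\mathfrak h=\ell^2(\mathbb Z)$, let $(uf)(x)=f(x-1)$ be the translation on $\mathfrak h$, and let $a^*(f),a(f)$, $f\in\mathfrak h$, be the creation and annihilation operators on the fermionic Fock space over $\mathfrak h$. For $F=[f_1,f_2]\in\mathfrak h\oplus\mathfrak h$ put $B(F)=a^*(f_1)+a(\bar f_2)$ and $J[f_1,f_2]=[\bar f_2,\bar f_1]$, and let $\mathfrak A$ be the $C^*$-algebra generated by all $B(F)$. A state $\omega$ on $\mathfrak A$ is quasifree if it vanishes on products of an odd number of generators and satisfies $\omega(B(F_1)\cdots B(F_{2n}))=\mathrm{pf}(\Omega)$, where $\Omega$ is the skew-symmetric matrix with $\Omega_{ij}=\omega(B(F_i)B(F_j))$ for $i<j$; it has density $S$ if $0\le S=S^*\le 1$, $JSJ=1-S$ and $\omega(B(F)^*B(G))=(F,SG)$ for all $F,G$. Let $\lambda\in\mathbb R$, $N\in\{0,1,2,\dots\}$ and $0<\beta_L\le\beta_R<\infty$, and put $h=\tfrac12(u+u^*)+\lambda$. Let $\tau^t$, $t\in\mathbb R$, be the $*$-automorphisms of $\mathfrak A$ with $\tau^t(B(F))=B(e^{it(h\oplus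 -h)}F)$. Let $h_L,h_R$ be the compressions of $h$ to $\ell^2(\{x\le -(N+1)\})$ and $\ell^2(\{x\ge N+1\})$, let $k_0=\beta_Lh_L\oplus 0\oplus\beta_Rh_R$, and let $\omega_0$ be the quasifree state on $\mathfrak A$ with density $$S_0=(1+e^{-k_0})^{-1}\oplus(1+e^{k_0})^{-1}.$$ A nonequilibrium steady state (NESS) is a state $\omega$ on $\mathfrak A$ that is a weak-$*$ limit point of $\frac1T\int_0^T\omega_0\circ\tau^t\,dt$ as $T\to\infty$. With $\delta_0$ the Kronecker function at $0$, let $G_1=[0,\delta_0]$, $G_2=JG_1=[\delta_0,0]$, $F_{2i-1}=(u^i\oplus u^i)G_1$, $F_{2i}=(u^i\oplus u^i)G_2$ for $i\ge 1$, and let $A_n=B(F_1)B(F_2)\cdots B(F_{2n})$ be the emptiness formation observable. Put $\beta=\frac{\beta_R+\beta_L}2$, $\delta=\frac{\beta_R-\beta_L}2$, $\operatorname{sign}(x)=1$ for $x\ge0$ and $\operatorname{sign}(x)=-1$ for $x<0$, and define the symbol $\hat s_-$ on the unit circle by $$\hat s_-(e^{ik})=\tfrac12\Big(1+\tanh\big[\tfrac12(\beta-\operatorname{sign}(\sin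 k)\,\delta)(\lambda+\cos k)\big]\Big).$$ **Proposition.** Let $\omega$ be a NESS as above and let $\mathrm P(n)=\omega(A_n)$ be its emptiness formation probability. Then $\mathrm P(n)\in[0,1]$ for all $n$. The Toeplitz operator $T[\hat s_-]$, $(T[\hat s_-]f)_i=\sum_j a_{i-j}f_j$ with $a_x=\int_{-\pi}^{\pi}\frac{dk}{2\pi}\,\hat s_-(e^{ik})e^{-ikx}$, is a bounded operator on $\ell^2(\mathbb N)$, and for all $n$ $$\mathrm P(n)=\det\big(T_n[\hat s_-]\big),$$ where $T_n[\hat s_-]$ is the $n\times n$ finite section of $T[\hat s_-]$. -/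

import Mathlib

open scoped ComplexOrder

noncomputable section

namespace XYChain

/-! ## Square-summable sequences and the operators `(T f)(a) = w(a) f(σ(a))` -/

/-- The complex Hilbert space `ℓ²(ι)`. -/
abbrev L2 (ι : Type) : Type := lp (fun _ : ι => ℂ) 2

/-- The Kronecker function `δ_i ∈ ℓ²(ι)`. -/
def kron {ι : Type} [DecidableEq ι] (i : ι) : L2 ι := lp.single 2 i 1

theorem sum_wcomp_le {α β : Type} (w : α → ℂ) (σ : α → β) (hw : ∀ a, ‖w a‖ ≤ 1)
    (hσ : ∀ a b, w a ≠ 0 → w b ≠ 0 → σ a = σ b → a = b) (f : L2 β) (s : Finset α) :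
    ∑ a ∈ s, ‖w a * f (σ a)‖ ^ (2 : ENNReal).toReal ≤ ‖f‖ ^ (2 : ENNReal).toReal := by
  classical
  have h2 : (0 : ℝ) < (2 : ENNReal).toReal := by norm_num
  calc ∑ a ∈ s, ‖w a * f (σ a)‖ ^ (2 : ENNReal).toReal
      = ∑ a ∈ s with w a ≠ 0, ‖w a * f (σ a)‖ ^ (2 : ENNReal).toReal := by
        rw [Finset.sum_filter]
        refine Finset.sum_congr rfl fun a _ => ?_
        by_cases h : w a = 0 <;> simp [h]
    _ ≤ ∑ a ∈ s with w a ≠ 0, ‖f (σ a)‖ ^ (2 : ENNReal).toReal := by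
        refine Finset.sum_le_sum fun a _ => ?_
        refine Real.rpow_le_rpow (norm_nonneg _) ?_ h2.le
        rw [norm_mul]
        exact mul_le_of_le_one_left (norm_nonneg _) (hw a)
    _ = ∑ b ∈ (s.filter fun a => w a ≠ 0).image σ, ‖f b‖ ^ (2 : ENNReal).toReal := by
        rw [Finset.sum_image]
        intro a ha b hb hab
        exact hσ a b (Finset.mem_filter.1 ha).2 (Finset.mem_filter.1 hb).2 hab
    _ ≤ ‖f‖ ^ (2 : ENNReal).toReal := lp.sum_rpow_le_norm_rpow h2 f _

/-- The bounded operator `(T f)(a) = w(a) f(σ(a))`, for a weight `w` bounded by one and a map `σ`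
that is injective on the support of `w`. -/
def wcomp {α β : Type} (w : α → ℂ) (σ : α → β) (hw : ∀ a, ‖w a‖ ≤ 1)
    (hσ : ∀ a b, w a ≠ 0 → w b ≠ 0 → σ a = σ b → a = b) : L2 β →L[ℂ] L2 α :=
  LinearMap.mkContinuous
    { toFun := fun f => ⟨fun a => w a * f (σ a), memℓp_gen' (sum_wcomp_le w σ hw hσ f)⟩
      map_add' := fun f g => by
        apply lp.ext; funext a
        simp only [lp.coeFn_add, Pi.add_apply, mul_add]
      map_smul' := fun c f => by
        apply lp.ext; funext a
        simp only [lp.coeFn_smul, Pi.smul_apply, smul_eq_mul, RingHom.id_apply]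
        ring }
    1 (fun f => by
      rw [one_mul]
      exact lp.norm_le_of_forall_sum_le (by norm_num) (norm_nonneg _) (sum_wcomp_le w σ hw hσ f))

@[simp] theorem wcomp_apply {α β : Type} (w : α → ℂ) (σ : α → β) (hw : ∀ a, ‖w a‖ ≤ 1)
    (hσ : ∀ a b, w a ≠ 0 → w b ≠ 0 → σ a = σ b → a = b) (f : L2 β) (a : α) :
    wcomp w σ hw hσ f a = w a * f (σ a) := rfl

/-! ## One-particle space -/

/-- The one-particle Hilbert space `𝔥 = ℓ²(ℤ)`. -/
abbrev OneParticle : Type := L2 ℤ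

/-- The doubled one-particle Hilbert space `𝔥 ⊕ 𝔥`. -/
abbrev Doubled : Type := WithLp 2 (OneParticle × OneParticle)

/-- The element `[f₁, f₂]` of `𝔥 ⊕ 𝔥`. -/
def pair (f₁ f₂ : OneParticle) : Doubled := WithLp.toLp 2 (f₁, f₂)

/-- The direct sum `A ⊕ D` of two bounded operators on `𝔥`. -/
def dsum (A D : OneParticle →L[ℂ] OneParticle) : Doubled →L[ℂ] Doubled :=
  ((WithLp.prodContinuousLinearEquiv 2 ℂ OneParticle OneParticle).symm :
      OneParticle × OneParticle →L[ℂ] Doubled) ∘L (A.prodMap D) ∘L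
    (WithLp.prodContinuousLinearEquiv 2 ℂ OneParticle OneParticle :
      Doubled →L[ℂ] OneParticle × OneParticle)

@[simp] theorem dsum_pair (A D : OneParticle →L[ℂ] OneParticle) (f₁ f₂ : OneParticle) :
    dsum A D (pair f₁ f₂) = pair (A f₁) (D f₂) := rfl

/-- The antiunitary involution `J[f₁, f₂] = [f̄₂, f̄₁]`; `star` is pointwise conjugation. -/
def J (F : Doubled) : Doubled := pair (star F.snd) (star F.fst)

/-- The translation `(u f)(x) = f(x - 1)`. -/
def shift : OneParticle →L[ℂ] OneParticle :=
  wcomp (fun _ => 1) (fun x : ℤ => x - 1) (by simp) (fun a b _ _ h => by simpa using h)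

/-- The coordinate projection of `ℓ²(ℤ)` onto `ℓ²(X)`, for `X ⊆ ℤ`. -/
def coordProj (X : Set ℤ) [DecidablePred (· ∈ X)] : OneParticle →L[ℂ] OneParticle :=
  wcomp (fun x => if x ∈ X then 1 else 0) id
    (fun a => by split_ifs <;> simp) (fun _ _ _ _ h => h)

/-- The one-particle Hamiltonian `h = Re(u) + λ`. -/
def ham (lam : ℝ) : OneParticle →L[ℂ] OneParticle :=
  (2⁻¹ : ℂ) • (shift + star shift) + (lam : ℂ) • 1

/-! ## Fermionic Fock space

The fermionic Fock space over `ℓ²(ℤ)` in its occupation number basis: the basis vector indexed by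
`A = {x₁ < ⋯ < x_k}` is `δ_{x₁} ∧ ⋯ ∧ δ_{x_k}`. -/

/-- The fermionic Fock space over `ℓ²(ℤ)`. -/
abbrev Fock : Type := L2 (Finset ℤ)

/-- The sign `(-1)^{#{y ∈ A : y < x}}`. -/
def jwSign (x : ℤ) (A : Finset ℤ) : ℂ := (-1) ^ (A.filter (· < x)).card

theorem norm_jwSign (x : ℤ) (A : Finset ℤ) : ‖jwSign x A‖ = 1 := by simp [jwSign]

/-- The creation operator `a*(δ_x)`: `δ_x ∧ e_A = (-1)^{#{y ∈ A : y < x}} e_{A ∪ {x}}` for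
`x ∉ A`. -/
def createAt (x : ℤ) : Fock →L[ℂ] Fock :=
  wcomp (fun A => if x ∈ A then jwSign x A else 0) (fun A => A.erase x)
    (fun A => by split_ifs <;> simp [norm_jwSign])
    (fun A B hA hB h => by
      have hA' : x ∈ A := by by_contra h'; simp [h'] at hA
      have hB' : x ∈ B := by by_contra h'; simp [h'] at hB
      rw [← Finset.insert_erase hA', ← Finset.insert_erase hB']
      exact congrArg (insert x) h)

/-- The annihilation operator `a(δ_x)`, the adjoint of `createAt x`. -/
def annihAt (x : ℤ) : Fock →L[ℂ] Fock :=
  wcomp (fun A => if x ∈ A then 0 else jwSign x A) (fun A => insert x A)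
    (fun A => by split_ifs <;> simp [norm_jwSign])
    (fun A B hA hB h => by
      have hA' : x ∉ A := by intro h'; simp [h'] at hA
      have hB' : x ∉ B := by intro h'; simp [h'] at hB
      rw [← Finset.erase_insert hA', ← Finset.erase_insert hB']
      exact congrArg (fun C => C.erase x) h)

theorem jwSign_insert {x y : ℤ} {A : Finset ℤ} (hy : y ∉ A) :
    jwSign x (insert y A) = if y < x then -jwSign x A else jwSign x A := by
  unfold jwSign
  rw [Finset.filter_insert]
  split_ifs with h
  · rw [Finset.card_insert_of_notMem (by simp [hy]), pow_succ]; ring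
  · rfl

theorem jwSign_erase {x y : ℤ} {A : Finset ℤ} (hy : y ∈ A) :
    jwSign x (A.erase y) = if y < x then -jwSign x A else jwSign x A := by
  have h := jwSign_insert (x := x) (Finset.notMem_erase y A)
  rw [Finset.insert_erase hy] at h
  rw [h]
  split_ifs <;> simp

theorem jwSign_mul_self (x : ℤ) (A : Finset ℤ) : jwSign x A * jwSign x A = 1 := by
  unfold jwSign
  rw [← pow_add, ← two_mul, pow_mul]
  simp

theorem conj_jwSign (x : ℤ) (A : Finset ℤ) : (starRingEnd ℂ) (jwSign x A) = jwSign x A := by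
  simp [jwSign]

theorem createAt_apply (x : ℤ) (ψ : Fock) (A : Finset ℤ) :
    createAt x ψ A = if x ∈ A then jwSign x A * ψ (A.erase x) else 0 := by
  simp [createAt]

theorem annihAt_apply (x : ℤ) (ψ : Fock) (A : Finset ℤ) :
    annihAt x ψ A = if x ∈ A then 0 else jwSign x A * ψ (insert x A) := by
  simp [annihAt]

theorem star_createAt (x : ℤ) : star (createAt x) = annihAt x := by
  rw [ContinuousLinearMap.star_eq_adjoint]
  symm
  rw [ContinuousLinearMap.eq_adjoint_iff]
  intro φ ψ
  rw [lp.inner_eq_tsum, lp.inner_eq_tsum]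
  let e : Finset ℤ ≃ Finset ℤ :=
    { toFun := fun A => if x ∈ A then A.erase x else insert x A
      invFun := fun A => if x ∈ A then A.erase x else insert x A
      left_inv := fun A => by by_cases h : x ∈ A <;> simp [h]
      right_inv := fun A => by by_cases h : x ∈ A <;> simp [h] }
  rw [← e.tsum_eq]
  refine tsum_congr fun A => ?_
  by_cases h : x ∈ A
  · have he : e A = A.erase x := by simp [e, h]
    rw [he, annihAt_apply, createAt_apply, jwSign_erase h]
    simp [h, conj_jwSign, Finset.insert_erase h]
    ring
  · have he : e A = insert x A := by simp [e, h]
    rw [he, annihAt_apply, createAt_apply]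
    simp [h]

/-- The canonical anticommutation relation `{a(δ_x), a*(δ_y)} = δ_{xy}`. -/
theorem annihAt_createAt (x y : ℤ) :
    annihAt x * createAt y + createAt y * annihAt x = if x = y then 1 else 0 := by
  ext1 ψ
  apply lp.ext
  funext A
  have key : (annihAt x (createAt y ψ)) A + (createAt y (annihAt x ψ)) A
      = if x = y then ψ A else 0 := by
    rw [annihAt_apply, createAt_apply, createAt_apply, annihAt_apply]
    by_cases hxy : x = y
    · subst hxy
      by_cases hx : x ∈ A
      · simp only [hx, if_true, zero_add, Finset.notMem_erase, if_false, Finset.insert_erase hx,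
          jwSign_erase hx, lt_irrefl]
        rw [← mul_assoc, jwSign_mul_self, one_mul]
      · simp only [hx, if_false, Finset.mem_insert_self, if_true, add_zero,
          Finset.erase_insert hx, jwSign_insert hx, lt_irrefl]
        rw [← mul_assoc, jwSign_mul_self, one_mul]
    · have hyx : y ≠ x := fun h => hxy h.symm
      by_cases hx : x ∈ A
      · simp [hx, hxy]
      · by_cases hy : y ∈ A
        · have h1 : (insert x A).erase y = insert x (A.erase y) :=
            Finset.erase_insert_of_ne hxy
          simp only [hx, hy, if_false, if_true, Finset.mem_insert, or_true, hxy, Finset.mem_erase,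
            and_false, h1, jwSign_insert hx, jwSign_erase hy]
          rcases lt_or_gt_of_ne hxy with h | h
          · simp [h, h.not_gt]; ring
          · simp [h, h.not_gt]; ring
        · simp [hx, hy, hxy, hyx]
  by_cases hxy : x = y <;> simpa [hxy] using key

theorem norm_sum_createAt_sq_le (f : ℤ → ℂ) (s : Finset ℤ) :
    ‖∑ x ∈ s, f x • createAt x‖ ^ 2 ≤ ∑ x ∈ s, ‖f x‖ ^ 2 := by
  set D : Fock →L[ℂ] Fock := ∑ x ∈ s, f x • createAt x with hD
  have hDs : star D = ∑ x ∈ s, (starRingEnd ℂ) (f x) • annihAt x := by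
    simp [hD, star_sum, star_smul, star_createAt]
  have hcar : star D * D + D * star D = ((∑ x ∈ s, ‖f x‖ ^ 2 : ℝ) : ℂ) • 1 := by
    rw [hDs, hD, Finset.sum_mul_sum, Finset.sum_mul_sum, Finset.sum_comm (s := s) (t := s)
      (f := fun x y => f x • createAt x * (starRingEnd ℂ) (f y) • annihAt y),
      ← Finset.sum_add_distrib]
    push_cast
    rw [Finset.sum_smul]
    refine Finset.sum_congr rfl fun x hx => ?_
    rw [← Finset.sum_add_distrib]
    have : ∀ y ∈ s, (starRingEnd ℂ) (f x) • annihAt x * f y • createAt y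
        + f y • createAt y * (starRingEnd ℂ) (f x) • annihAt x
        = if x = y then ((‖f x‖ : ℂ) ^ 2) • (1 : Fock →L[ℂ] Fock) else 0 := by
      intro y _
      rw [smul_mul_smul_comm, smul_mul_smul_comm, mul_comm (f y), ← smul_add, annihAt_createAt]
      split_ifs with h
      · subst h
        rw [← Complex.normSq_eq_conj_mul_self, Complex.normSq_eq_norm_sq]
        push_cast
        rfl
      · simp
    rw [Finset.sum_congr rfl this, Finset.sum_ite_eq]
    simp [hx]
  set S : ℝ := ∑ x ∈ s, ‖f x‖ ^ 2 with hS
  have hS0 : 0 ≤ S := Finset.sum_nonneg fun _ _ => by positivity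
  have hbound : ‖D‖ ≤ Real.sqrt S := by
    refine ContinuousLinearMap.opNorm_le_bound _ (Real.sqrt_nonneg _) fun ψ => ?_
    have h1 : inner ℂ ψ ((star D * D + D * star D) ψ)
        = ((‖D ψ‖ ^ 2 + ‖star D ψ‖ ^ 2 : ℝ) : ℂ) := by
      have e1 : inner ℂ ψ (star D (D ψ)) = inner ℂ (D ψ) (D ψ) := by
        rw [ContinuousLinearMap.star_eq_adjoint, ContinuousLinearMap.adjoint_inner_right]
      have e2 : inner ℂ ψ (D (star D ψ)) = inner ℂ (star D ψ) (star D ψ) := by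
        rw [ContinuousLinearMap.star_eq_adjoint, ContinuousLinearMap.adjoint_inner_left]
      have e3 : (star D * D + D * star D) ψ = star D (D ψ) + D (star D ψ) := rfl
      rw [e3, inner_add_right, e1, e2, inner_self_eq_norm_sq_to_K, inner_self_eq_norm_sq_to_K]
      push_cast
      rfl
    have h2 : inner ℂ ψ ((star D * D + D * star D) ψ) = ((S * ‖ψ‖ ^ 2 : ℝ) : ℂ) := by
      have e3 : ((S : ℂ) • (1 : Fock →L[ℂ] Fock)) ψ = (S : ℂ) • ψ := rfl
      rw [hcar, e3, inner_smul_right, inner_self_eq_norm_sq_to_K]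
      push_cast
      rfl
    have h3 : ‖D ψ‖ ^ 2 + ‖star D ψ‖ ^ 2 = S * ‖ψ‖ ^ 2 := by
      exact_mod_cast h1.symm.trans h2
    refine le_of_sq_le_sq ?_ (by positivity)
    rw [mul_pow, Real.sq_sqrt hS0, ← h3]
    linarith [sq_nonneg ‖star D ψ‖]
  calc ‖D‖ ^ 2 ≤ Real.sqrt S ^ 2 := by gcongr
    _ = S := Real.sq_sqrt hS0

theorem summable_createAt (f : OneParticle) : Summable fun x => f x • createAt x := by
  rw [summable_iff_vanishing_norm]
  intro ε hε
  have hf : Summable fun x => ‖f x‖ ^ 2 := by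
    simpa using (lp.memℓp f).summable (by norm_num)
  obtain ⟨s, hs⟩ := summable_iff_vanishing_norm.1 hf (ε ^ 2) (by positivity)
  refine ⟨s, fun t ht => ?_⟩
  have h1 := norm_sum_createAt_sq_le f t
  have h2 := lt_of_le_of_lt (le_abs_self _) (hs t ht)
  exact lt_of_pow_lt_pow_left₀ 2 hε.le (h1.trans_lt h2)

/-- The creation operator `a*(f) = ∑ₓ f(x) a*(δ_x)`, a series that converges in operator norm for
every `f ∈ ℓ²(ℤ)` (`summable_createAt`). -/
def create (f : OneParticle) : Fock →L[ℂ] Fock := ∑' x : ℤ, f x • createAt x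

/-- The annihilation operator `a(f) = a*(f)*`. -/
def annih (f : OneParticle) : Fock →L[ℂ] Fock := star (create f)

/-- The operator `B(F) = a*(f₁) + a(f̄₂)` on Fock space, for `F = [f₁, f₂]`. -/
def fieldOp (F : Doubled) : Fock →L[ℂ] Fock := create F.fst + annih (star F.snd)

/-! ## The selfdual CAR algebra, states, and quasifree states -/

/-- The selfdual CAR algebra `𝔄`: the C*-algebra of operators on Fock space generated by all
`B(F)`. -/
def carAlgebra : StarSubalgebra ℂ (Fock →L[ℂ] Fock) :=
  (StarAlgebra.adjoin ℂ (Set.range fieldOp)).topologicalClosure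

/-- `𝔄` as a type. -/
abbrev CAR : Type := carAlgebra

/-- The generator `B(F)` as an element of `𝔄`. -/
def B (F : Doubled) : CAR :=
  ⟨fieldOp F, StarSubalgebra.le_topologicalClosure _
    (StarAlgebra.subset_adjoin ℂ _ (Set.mem_range_self F))⟩

/-- States on `𝔄`: normalized positive linear functionals. -/
def IsState (ω : CAR →ₗ[ℂ] ℂ) : Prop := ω 1 = 1 ∧ ∀ A : CAR, 0 ≤ ω (star A * A)

/-- `S` is the density of `ω`: `0 ≤ S* = S ≤ 1`, `J S J = 1 - S`, and
`ω(B*(F) B(G)) = (F, S G)`. -/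
def IsDensity (ω : CAR →ₗ[ℂ] ℂ) (S : Doubled →L[ℂ] Doubled) : Prop :=
  S.IsPositive ∧ (1 - S).IsPositive ∧ (∀ F, J (S (J F)) = F - S F) ∧
    ∀ F G : Doubled, ω (star (B F) * B G) = inner ℂ F (S G)

/-- The Pfaffian of a `2n × 2n` matrix, as a sum over the pairings: the permutations `π` with
`π(2j-1) < π(2j+1)` and `π(2j-1) < π(2j)` (indices are counted from zero below). -/
def pf {n : ℕ} (A : Matrix (Fin (2 * n)) (Fin (2 * n)) ℂ) : ℂ :=
  ∑ π : Equiv.Perm (Fin (2 * n)) with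
      (∀ i j : Fin n, i < j → π ⟨2 * i, by omega⟩ < π ⟨2 * j, by omega⟩) ∧
      (∀ j : Fin n, π ⟨2 * j, by omega⟩ < π ⟨2 * j + 1, by omega⟩),
    ((Equiv.Perm.sign π : ℤ) : ℂ) *
      ∏ j : Fin n, A (π ⟨2 * j, by omega⟩) (π ⟨2 * j + 1, by omega⟩)

/-- The skew-symmetric correlation matrix of `ω` for the form factors `F`. -/
def corrMatrix (ω : CAR →ₗ[ℂ] ℂ) {m : ℕ} (F : Fin m → Doubled) : Matrix (Fin m) (Fin m) ℂ :=
  Matrix.of fun i j =>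
    if i < j then ω (B (F i) * B (F j)) else if j < i then -ω (B (F j) * B (F i)) else 0

/-- The ordered product `B(F₁) ⋯ B(F_m)`. -/
def fieldProd {m : ℕ} (F : Fin m → Doubled) : CAR := (List.ofFn fun i => B (F i)).prod

/-- Quasifree states. -/
def IsQuasifree (ω : CAR →ₗ[ℂ] ℂ) : Prop :=
  IsState ω ∧ (∀ (n : ℕ) (F : Fin (2 * n + 1) → Doubled), ω (fieldProd F) = 0) ∧
    ∀ (n : ℕ) (F : Fin (2 * n) → Doubled), ω (fieldProd F) = pf (corrMatrix ω F)

/-! ## Dynamics, initial state, and nonequilibrium steady states -/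

/-- `τ` is the coupled time evolution: the family of `*`-automorphisms of `𝔄` determined by
`τ^t(B(F)) = B(e^{it(h ⊕ -h)} F)`. -/
def IsDynamics (lam : ℝ) (τ : ℝ → CAR ≃⋆ₐ[ℂ] CAR) : Prop :=
  ∀ (t : ℝ) (F : Doubled),
    τ t (B F) = B (NormedSpace.exp ((Complex.I * t) • dsum (ham lam) (-ham lam)) F)

/-- The operator `k₀ = β_L h_L ⊕ 0 ⊕ β_R h_R` on `ℓ²(ℤ_L) ⊕ ℓ²(ℤ_S) ⊕ ℓ²(ℤ_R) = ℓ²(ℤ)`, where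
`ℤ_L = {x ≤ -(N+1)}`, `ℤ_R = {x ≥ N+1}`, and `h_L`, `h_R` are the compressions of `h`. -/
def kZero (N : ℕ) (lam βL βR : ℝ) : OneParticle →L[ℂ] OneParticle :=
  (βL : ℂ) • (coordProj {x | x ≤ -((N : ℤ) + 1)} * ham lam * coordProj {x | x ≤ -((N : ℤ) + 1)}) +
  (βR : ℂ) • (coordProj {x | (N : ℤ) + 1 ≤ x} * ham lam * coordProj {x | (N : ℤ) + 1 ≤ x})

/-- The initial density `S₀ = (1 + e^{-k₀})⁻¹ ⊕ (1 + e^{k₀})⁻¹`. -/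
def initialDensity (N : ℕ) (lam βL βR : ℝ) : Doubled →L[ℂ] Doubled :=
  dsum (Ring.inverse (1 + NormedSpace.exp (-kZero N lam βL βR)))
    (Ring.inverse (1 + NormedSpace.exp (kZero N lam βL βR)))

/-- `ω₀` is the initial state: the quasifree state with density `S₀`. -/
def IsInitialState (N : ℕ) (lam βL βR : ℝ) (ω₀ : CAR →ₗ[ℂ] ℂ) : Prop :=
  IsQuasifree ω₀ ∧ IsDensity ω₀ (initialDensity N lam βL βR)

/-- `ω` is a nonequilibrium steady state (NESS): a state that is a limit point, for `T → ∞` and in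
the weak-`*` topology (pointwise convergence on `𝔄`), of the means
`T⁻¹ ∫₀ᵀ ω₀ ∘ τ^t dt`. -/
def IsNESS (τ : ℝ → CAR ≃⋆ₐ[ℂ] CAR) (ω₀ ω : CAR →ₗ[ℂ] ℂ) : Prop :=
  IsState ω ∧
    MapClusterPt (fun A : CAR => ω A) Filter.atTop
      (fun (T : ℝ) (A : CAR) => (T : ℂ)⁻¹ * ∫ t in (0 : ℝ)..T, ω₀ (τ t A))

/-! ## The emptiness formation observable -/

/-- The initial form factors `G₁ = [0, δ₀]` and `G₂ = J G₁ = [δ₀, 0]`. -/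
def G₁ : Doubled := pair 0 (kron 0)

/-- See `G₁`. -/
def G₂ : Doubled := pair (kron 0) 0

/-- The form factors `F_{2i-1} = (uⁱ ⊕ uⁱ) G₁` and `F_{2i} = (uⁱ ⊕ uⁱ) G₂` for `i ≥ 1`; the
argument `m` is the index counted from zero, so that `F_{m+1}` is `formFactor m`. -/
def formFactor (m : ℕ) : Doubled :=
  dsum (shift ^ (m / 2 + 1)) (shift ^ (m / 2 + 1)) (if m % 2 = 0 then G₁ else G₂)

/-- The emptiness formation observable `A_n = B(F₁) ⋯ B(F_{2n})`. -/
def efpObservable (n : ℕ) : CAR := fieldProd fun m : Fin (2 * n) => formFactor m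

/-! ## The symbol and its Toeplitz operator -/

/-- The sign function with values in `{±1}` and value `1` at `0`. -/
def sgn (x : ℝ) : ℝ := if 0 ≤ x then 1 else -1

/-- `ϱ₋(e^{ik}) = tanh[½ (β - sgn(sin k) δ)(λ + cos k)]` with `β = (β_R + β_L)/2` and
`δ = (β_R - β_L)/2`. -/
def rhoMinus (lam βL βR : ℝ) (z : Circle) : ℝ :=
  Real.tanh ((1 / 2) * ((βR + βL) / 2 - sgn (z : ℂ).im * ((βR - βL) / 2)) * (lam + (z : ℂ).re))

/-- The symbol `ŝ₋ = ½ (1 + ϱ₋)`. -/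
def sHatMinus (lam βL βR : ℝ) (z : Circle) : ℂ := (((1 / 2) * (1 + rhoMinus lam βL βR z) : ℝ) : ℂ)

/-- The Fourier coefficients `a_x = (2π)⁻¹ ∫_{-π}^{π} a(e^{ik}) e^{-ikx} dk`. -/
def symbolCoeff (a : Circle → ℂ) (x : ℤ) : ℂ :=
  (2 * (Real.pi : ℂ))⁻¹ *
    ∫ k in (-Real.pi)..Real.pi, a (Circle.exp k) * Complex.exp (-(Complex.I * k * x))

/-- `T` is the Toeplitz operator `T[a]` on `ℓ²(ℕ)`: `(T f)_i = ∑_j a_{i-j} f_j`. -/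
def IsToeplitzOperator (a : Circle → ℂ) (T : L2 ℕ →L[ℂ] L2 ℕ) : Prop :=
  ∀ (f : L2 ℕ) (i : ℕ), HasSum (fun j : ℕ => symbolCoeff a ((i : ℤ) - (j : ℤ)) * f j) (T f i)

/-- The finite section `P_n T P_n` on the range of `P_n`, as an `n × n` matrix. -/
def finiteSection (n : ℕ) (T : L2 ℕ →L[ℂ] L2 ℕ) : Matrix (Fin n) (Fin n) ℂ :=
  Matrix.of fun i j => inner ℂ (kron (i : ℕ)) (T (kron (j : ℕ)))

end XYChain

end

open XYChain

/-!
The observable is `A_n = ∏ a(δ_x) a*(δ_x)` over the sites `x = 1, …, n`. The factors are commuting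
projections, so `A_n` is a projection and `0 ≤ P(n) ≤ 1` (`state_apply_isStarProjection`). For the
determinant the anticommutation relations are used to nest the product as
`a(δ₁) ⋯ a(δ_n) a*(δ_n) ⋯ a*(δ₁)` (`efpObservable_eq_fieldProd_nested`). The dynamics and the
initial density are block diagonal in `𝔥 ⊕ 𝔥`, so that in `ω₀ ∘ τ^t` only pairings of an `a` with an
`a*` contribute to the Pfaffian, which therefore is `± det M(t)` (`exists_sign_pf_eq_det`) for the
matrix `M(t)_{ij} = (e^{ith} δ_i, (1 + e^{-k₀})⁻¹ e^{ith} δ_j)`. Its sign need not be computed: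
`ω₀(τ^t(A_n)) ≥ 0` because `A_n` is a projection, and `det M(t) ≥ 0` because `M(t)` is positive
semidefinite (`initial_efp_eq_det`).

It remains to show that `M(t)` converges as `t → ∞` to the Toeplitz matrix of the symbol
(`tendsto_twoPoint`); time averages and their limit points then have the same limit. In the momentum
representation `h` is the multiplication by `λ + cos k`. The position observable at time `t` is,
after division by `t`, asymptotic to the group velocity `-sin k`: the characteristic function of
`x / t` in the state `e^{ith} ψ` is the overlap of `e^{it cos k} ψ̂(k)` with its translate by
`s / t`, and it converges by dominated convergence. Lévy's convergence theorem and the fact that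
`sin k = 0` is a null set show that the part of the wave packet in `x ≤ y` consists, for every
fixed `y`, of the momenta with `sin k ≥ 0` (`tendsto_inner_packet_coordProj`). Since the limit does not depend on `y`,
wave packets leave every site (`tendsto_packet_apply`). Up to terms that are supported on finitely
many sites, `k₀` acts as `β_L h` on the left and as `β_R h` on the right, hence so do polynomials in
`k₀` (`tendsto_aeval_kZero_packet`), and polynomials approximate `x ↦ (1 + e^{-x})⁻¹` uniformly on
compact intervals. The limit is the Fourier coefficient of the function that equals
`(1 + e^{-β_L (λ + cos k)})⁻¹` where `sin k ≥ 0` and `(1 + e^{-β_R (λ + cos k)})⁻¹` where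
`sin k < 0`, which is the symbol `ŝ₋` (`sHatMinus_eq_fermi`).
-/

noncomputable section

namespace XYChain

/-! ### Pfaffians of bipartite matrices -/

/-- The bijection `Fin n ⊕ Fin n ≃ Fin (2n)` whose two halves are the even and the odd indices. -/
def interleave (n : ℕ) : Fin n ⊕ Fin n ≃ Fin (2 * n) :=
  Equiv.ofBijective
    (Sum.elim (fun j => ⟨2 * j, by omega⟩) (fun j => ⟨2 * j + 1, by omega⟩)) <| by
    rw [Fintype.bijective_iff_injective_and_card]
    refine ⟨?_, by simp [two_mul]⟩
    rintro (i | i) (j | j) h <;> simp [Fin.ext_iff] at h ⊢ <;> omega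

/-- The bijection `Fin n ⊕ Fin n ≃ Fin (2n)` that enumerates the first half of the indices
upwards and the second half downwards. -/
def nested (n : ℕ) : Fin n ⊕ Fin n ≃ Fin (2 * n) :=
  Equiv.ofBijective
    (Sum.elim (fun j => ⟨j, by omega⟩) (fun j => ⟨2 * n - 1 - j, by omega⟩)) <| by
    rw [Fintype.bijective_iff_injective_and_card]
    refine ⟨?_, by simp [two_mul]⟩
    rintro (i | i) (j | j) h <;> simp [Fin.ext_iff] at h ⊢ <;> omega

/-- The permutation that represents the pairing `j ↔ 2n - 1 - σ(j)`. -/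
def pairingPerm {n : ℕ} (σ : Equiv.Perm (Fin n)) : Equiv.Perm (Fin (2 * n)) :=
  (interleave n).symm.trans ((Equiv.sumCongr 1 σ).trans (nested n))

theorem pairingPerm_even {n : ℕ} (σ : Equiv.Perm (Fin n)) (j : Fin n) :
    pairingPerm σ ⟨2 * j, by omega⟩ = ⟨j, by omega⟩ := by
  have : (⟨2 * j, by omega⟩ : Fin (2 * n)) = interleave n (Sum.inl j) := rfl
  rw [this]
  simp [pairingPerm, nested]

theorem pairingPerm_odd {n : ℕ} (σ : Equiv.Perm (Fin n)) (j : Fin n) :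
    pairingPerm σ ⟨2 * j + 1, by omega⟩ = ⟨2 * n - 1 - σ j, by omega⟩ := by
  have : (⟨2 * j + 1, by omega⟩ : Fin (2 * n)) = interleave n (Sum.inr j) := rfl
  rw [this]
  simp [pairingPerm, nested]

theorem sign_pairingPerm {n : ℕ} (σ : Equiv.Perm (Fin n)) :
    Equiv.Perm.sign (pairingPerm σ) =
      Equiv.Perm.sign ((interleave n).symm.trans (nested n)) * Equiv.Perm.sign σ := by
  have : pairingPerm σ = ((interleave n).symm.trans (nested n)) *
      (interleave n).permCongr (Equiv.sumCongr 1 σ) := by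
    ext x
    simp [pairingPerm, Equiv.permCongr_def]
  rw [this, Equiv.Perm.sign_mul, Equiv.Perm.sign_permCongr]
  congr 1
  exact (Equiv.Perm.sign_sumCongr 1 σ).trans (by simp)

theorem perm_ext_even_odd {n : ℕ} {π ρ : Equiv.Perm (Fin (2 * n))}
    (he : ∀ j : Fin n, π ⟨2 * j, by omega⟩ = ρ ⟨2 * j, by omega⟩)
    (ho : ∀ j : Fin n, π ⟨2 * j + 1, by omega⟩ = ρ ⟨2 * j + 1, by omega⟩) : π = ρ := by
  ext1 x
  obtain ⟨y, rfl⟩ := (interleave n).surjective x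
  rcases y with j | j
  · exact he j
  · exact ho j

/-- If the two halves of the index set are isotropic, then a pairing contributes to the Pfaffian
only if it matches the first half with the second half, and the Pfaffian is, up to a sign that
depends on `n` only, the determinant of the off-diagonal block. -/
theorem exists_sign_pf_eq_det {n : ℕ} (A : Matrix (Fin (2 * n)) (Fin (2 * n)) ℂ)
    (h₁ : ∀ i j : Fin (2 * n), i < j → (j : ℕ) < n → A i j = 0)
    (h₂ : ∀ i j : Fin (2 * n), i < j → n ≤ (i : ℕ) → A i j = 0) :
    ∃ c : ℤˣ, pf A = ((c : ℤ) : ℂ) *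
      (Matrix.of fun i j : Fin n => A ⟨i, by omega⟩ ⟨2 * n - 1 - j, by omega⟩).det := by
  refine ⟨Equiv.Perm.sign ((interleave n).symm.trans (nested n)), ?_⟩
  rw [← Matrix.det_transpose, Matrix.det_apply', Finset.mul_sum, pf]
  symm
  refine Finset.sum_of_injOn pairingPerm ?_ ?_ ?_ ?_
  · intro σ _ ρ _ h
    ext1 j
    have := congrArg (fun π : Equiv.Perm (Fin (2 * n)) => π ⟨2 * j + 1, by omega⟩) h
    simp only [pairingPerm_odd, Fin.mk.injEq] at this
    ext1
    omega
  · intro σ _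
    simp only [Finset.coe_filter, Finset.mem_univ, true_and, Set.mem_ofPred_eq]
    refine ⟨fun i j hij => ?_, fun j => ?_⟩
    · rw [pairingPerm_even, pairingPerm_even]; exact hij
    · rw [pairingPerm_even, pairingPerm_odd, Fin.mk_lt_mk]; omega
  · intro π hπ hn
    obtain ⟨hmono, hlt⟩ := (Finset.mem_filter.1 hπ).2
    rw [mul_eq_zero]
    right
    by_contra hne
    rw [Finset.prod_eq_zero_iff.not] at hne
    push Not at hne
    -- a pairing with a nonzero weight opens in the first half and closes in the second
    have hlo : ∀ j : Fin n, (π ⟨2 * j, by omega⟩ : ℕ) < n := fun j => by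
      by_contra h
      exact hne j (Finset.mem_univ _) (h₂ _ _ (hlt j) (not_lt.1 h))
    have hhi : ∀ j : Fin n, n ≤ (π ⟨2 * j + 1, by omega⟩ : ℕ) := fun j => by
      by_contra h
      exact hne j (Finset.mem_univ _) (h₁ _ _ (hlt j) (not_le.1 h))
    have hmono' : StrictMono fun j : Fin n => (⟨π ⟨2 * j, by omega⟩, hlo j⟩ : Fin n) :=
      fun i j hij => hmono i j hij
    -- the openings increase, so that they exhaust the first half in its order
    have hid : ∀ j : Fin n, (π ⟨2 * j, by omega⟩ : ℕ) = j := fun j => by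
      let e : Fin n ≃o Fin n :=
        hmono'.orderIsoOfSurjective _ (Finite.injective_iff_surjective.1 hmono'.injective)
      have he : e = OrderIso.refl _ := Subsingleton.elim _ _
      exact congrArg (fun f : Fin n ≃o Fin n => (f j : ℕ)) he
    let s : Fin n → Fin n := fun j => ⟨2 * n - 1 - π ⟨2 * j + 1, by omega⟩, by
      have := hhi j; omega⟩
    have hs : Function.Injective s := fun i j hij => by
      have h1 := hhi i
      have h2 := hhi j
      simp only [s, Fin.mk.injEq] at hij
      have h3 : π ⟨2 * i + 1, by omega⟩ = π ⟨2 * j + 1, by omega⟩ := by ext1; omega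
      have := π.injective h3
      simp only [Fin.mk.injEq] at this
      ext1; omega
    refine hn ⟨Equiv.ofBijective s (Finite.injective_iff_bijective.1 hs), by simp, ?_⟩
    refine perm_ext_even_odd (fun j => ?_) (fun j => ?_)
    · rw [pairingPerm_even]; ext1; exact (hid j).symm
    · rw [pairingPerm_odd]
      ext1
      have := hhi j
      simp only [Equiv.ofBijective_apply, s]
      omega
  · intro σ _
    rw [sign_pairingPerm]
    simp only [pairingPerm_even, pairingPerm_odd, Matrix.transpose_apply, Matrix.of_apply]
    push_cast
    ring

/-! ### The canonical anticommutation relations -/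

theorem kron_apply {ι : Type} [DecidableEq ι] (i j : ι) :
    kron i j = if j = i then 1 else 0 := by
  by_cases h : j = i
  · subst h; simp [kron, lp.single_apply]
  · simp [kron, lp.single_apply, h]

theorem create_kron (x : ℤ) : create (kron x) = createAt x := by
  rw [create, tsum_eq_single x]
  · simp [kron_apply]
  · intro y hy
    simp [kron_apply, hy]

theorem create_zero : create 0 = 0 := by simp [create]

theorem fieldOp_pair_kron_zero (x : ℤ) : fieldOp (pair (kron x) 0) = createAt x := by
  simp [fieldOp, pair, annih, create_kron, create_zero]

theorem star_kron (x : ℤ) : star (kron x) = kron x := by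
  apply lp.ext
  funext y
  rw [lp.star_apply, kron_apply]
  split_ifs <;> simp

theorem fieldOp_pair_zero_kron (x : ℤ) : fieldOp (pair 0 (kron x)) = annihAt x := by
  simp [fieldOp, pair, annih, create_kron, create_zero, star_kron, star_createAt]

theorem createAt_createAt (x y : ℤ) :
    createAt x * createAt y + createAt y * createAt x = 0 := by
  ext1 ψ
  apply lp.ext
  funext A
  show createAt x (createAt y ψ) A + createAt y (createAt x ψ) A = 0
  simp only [createAt_apply]
  by_cases hxy : x = y
  · subst hxy; simp
  have hyx : y ≠ x := fun h => hxy h.symm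
  by_cases hx : x ∈ A <;> by_cases hy : y ∈ A <;>
    simp only [hx, hy, Finset.mem_erase, ne_eq, hxy, hyx, not_false_eq_true, and_true, and_false,
      if_true, if_false, mul_zero, add_zero]
  rw [jwSign_erase hx, jwSign_erase hy, Finset.erase_right_comm]
  rcases lt_or_gt_of_ne hxy with h | h <;> simp [h, h.not_gt] <;> ring

theorem annihAt_annihAt (x y : ℤ) : annihAt x * annihAt y + annihAt y * annihAt x = 0 := by
  have := congrArg star (createAt_createAt y x)
  simpa [star_createAt] using this

/-- The annihilation operator `a(δ_x)` as an element of `𝔄`. -/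
def annihGen (x : ℤ) : CAR := B (pair 0 (kron x))

theorem coe_annihGen (x : ℤ) : (annihGen x : Fock →L[ℂ] Fock) = annihAt x :=
  fieldOp_pair_zero_kron x

theorem star_B_pair_kron_zero (x : ℤ) : star (B (pair (kron x) 0)) = annihGen x := by
  apply Subtype.ext
  show star (fieldOp (pair (kron x) 0)) = _
  rw [fieldOp_pair_kron_zero, coe_annihGen, star_createAt]

theorem star_annihGen (x : ℤ) : star (annihGen x) = B (pair (kron x) 0) := by
  rw [← star_B_pair_kron_zero, star_star]

theorem coe_star_annihGen (x : ℤ) :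
    ((star (annihGen x) : CAR) : Fock →L[ℂ] Fock) = createAt x := by
  rw [star_annihGen]; exact fieldOp_pair_kron_zero x

theorem annihGen_mul_annihGen (x y : ℤ) :
    annihGen x * annihGen y = -(annihGen y * annihGen x) := by
  apply Subtype.ext
  simpa [coe_annihGen] using eq_neg_of_add_eq_zero_left (annihAt_annihAt x y)

theorem annihGen_mul_star_of_ne {x y : ℤ} (h : x ≠ y) :
    annihGen x * star (annihGen y) = -(star (annihGen y) * annihGen x) := by
  apply Subtype.ext
  have := annihAt_createAt x y
  rw [if_neg h] at this
  rw [MulMemClass.coe_mul, NegMemClass.coe_neg, MulMemClass.coe_mul, coe_star_annihGen,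
    coe_annihGen]
  exact eq_neg_of_add_eq_zero_left this

theorem annihGen_mul_star_self (x : ℤ) :
    annihGen x * star (annihGen x) = 1 - star (annihGen x) * annihGen x := by
  apply Subtype.ext
  have := annihAt_createAt x x
  rw [if_pos rfl] at this
  rw [MulMemClass.coe_mul, AddSubgroupClass.coe_sub, MulMemClass.coe_mul, coe_star_annihGen,
    coe_annihGen]
  exact eq_sub_of_add_eq this

theorem annihGen_mul_self (x : ℤ) : annihGen x * annihGen x = 0 := by
  have h := add_eq_zero_iff_eq_neg.2 (annihGen_mul_annihGen x x)
  rw [← two_smul ℂ] at h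
  exact (smul_eq_zero.1 h).resolve_left two_ne_zero

/-! ### The emptiness formation observable is a projection -/

/-- The projection `a(δ_x) a*(δ_x)` onto the states with an empty site `x`. -/
def emptySite (x : ℤ) : CAR := annihGen x * star (annihGen x)

theorem commute_emptySite_annihGen {x y : ℤ} (h : x ≠ y) :
    Commute (emptySite x) (annihGen y) := by
  show annihGen x * star (annihGen x) * annihGen y = annihGen y * (annihGen x * star (annihGen x))
  have h1 : star (annihGen x) * annihGen y = -(annihGen y * star (annihGen x)) := by
    rw [annihGen_mul_star_of_ne h.symm, neg_neg]
  rw [mul_assoc, h1, mul_neg, ← mul_assoc, annihGen_mul_annihGen x y, neg_mul, neg_neg, mul_assoc]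

theorem isStarProjection_emptySite (x : ℤ) : IsStarProjection (emptySite x) := by
  refine ⟨?_, by simp [emptySite, IsSelfAdjoint]⟩
  show emptySite x * emptySite x = emptySite x
  conv_lhs => rw [emptySite, annihGen_mul_star_self, ← annihGen_mul_star_self]
  have : emptySite x * annihGen x = annihGen x := by
    rw [emptySite, annihGen_mul_star_self, sub_mul, one_mul, mul_assoc, annihGen_mul_self,
      mul_zero, sub_zero]
  rw [emptySite, ← mul_assoc, ← emptySite, this]
  rfl

/-- The product `a(δ₁) ⋯ a(δ_n)`. -/
def annihProd (n : ℕ) : CAR := ((List.range n).map fun i : ℕ => annihGen (i + 1)).prod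

theorem annihProd_succ (n : ℕ) : annihProd (n + 1) = annihProd n * annihGen (n + 1) := by
  simp [annihProd, List.range_succ]

theorem commute_emptySite_annihProd (n m : ℕ) (h : n ≤ m) :
    Commute (emptySite (m + 1)) (annihProd n) := by
  induction n with
  | zero => simp [annihProd]
  | succ n ih =>
    rw [annihProd_succ]
    exact (ih (by omega)).mul_right (commute_emptySite_annihGen (by omega))

theorem fieldProd_eq_prod_map {m : ℕ} (F : ℕ → Doubled) :
    fieldProd (fun i : Fin m => F i) = ((List.range m).map fun i => B (F i)).prod := by
  rw [fieldProd, ← List.map_coe_finRange_eq_range, List.map_map, List.ofFn_eq_map]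
  rfl

theorem shift_pow_kron (m : ℕ) (x : ℤ) : (shift ^ m) (kron x) = kron (x + m) := by
  induction m with
  | zero => simp
  | succ m ih =>
    rw [pow_succ', mul_apply_eq_comp, ih]
    apply lp.ext
    funext y
    show (1 : ℂ) * kron (x + m) (y - 1) = _
    simp only [kron_apply, one_mul]
    congr 1
    push_cast
    exact propext ⟨fun h => by omega, fun h => by omega⟩

theorem formFactor_even (n : ℕ) : formFactor (2 * n) = pair 0 (kron (n + 1)) := by
  have : 2 * n / 2 = n := by omega
  rw [formFactor, this, if_pos (by omega), G₁, dsum_pair, map_zero, shift_pow_kron]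
  congr 2
  push_cast
  ring

theorem formFactor_odd (n : ℕ) : formFactor (2 * n + 1) = pair (kron (n + 1)) 0 := by
  have h1 : (2 * n + 1) / 2 = n := by omega
  rw [formFactor, h1, if_neg (by omega), G₂, dsum_pair, map_zero, shift_pow_kron]
  congr 2
  push_cast
  ring

theorem efpObservable_succ (n : ℕ) :
    efpObservable (n + 1) = efpObservable n * emptySite (n + 1) := by
  rw [efpObservable, efpObservable, fieldProd_eq_prod_map, fieldProd_eq_prod_map,
    show 2 * (n + 1) = 2 * n + 1 + 1 by ring, List.range_succ, List.range_succ]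
  simp only [List.map_append, List.prod_append, List.map_cons, List.map_nil, List.prod_cons,
    List.prod_nil, mul_one, formFactor_even, formFactor_odd]
  rw [emptySite, star_annihGen, mul_assoc, annihGen]

/-- Since `a(δ_x) a*(δ_x)` commutes with the other generators, the observable can be nested as
`a(δ₁) ⋯ a(δ_n) a*(δ_n) ⋯ a*(δ₁)`. -/
theorem efpObservable_eq_mul_star (n : ℕ) :
    efpObservable n = annihProd n * star (annihProd n) := by
  induction n with
  | zero => simp [efpObservable, fieldProd, annihProd]
  | succ n ih =>
    have h : Commute (emptySite (n + 1)) (star (annihProd n)) := by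
      have := (commute_emptySite_annihProd n n le_rfl).star_star
      rwa [(isStarProjection_emptySite _).isSelfAdjoint.star_eq] at this
    rw [efpObservable_succ, ih, annihProd_succ, star_mul, mul_assoc, ← h.eq, emptySite]
    simp only [mul_assoc]

theorem isStarProjection_efpObservable (n : ℕ) : IsStarProjection (efpObservable n) := by
  induction n with
  | zero => simp [efpObservable, fieldProd]
  | succ n ih =>
    rw [efpObservable_succ]
    refine ih.mul (isStarProjection_emptySite _) ?_
    rw [efpObservable_eq_mul_star]
    have h := commute_emptySite_annihProd n n le_rfl
    refine (h.mul_right ?_).symm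
    have := h.star_star
    rwa [(isStarProjection_emptySite _).isSelfAdjoint.star_eq] at this

theorem star_annihProd (n : ℕ) : star (annihProd n) =
    ((List.range n).map fun i : ℕ => star (annihGen ((n - i : ℕ) : ℤ))).prod := by
  induction n with
  | zero => simp [annihProd]
  | succ n ih =>
    rw [annihProd_succ, star_mul, ih, List.range_succ_eq_map]
    simp [Function.comp_def]

/-- The form factors `[0, δ₁], …, [0, δ_n], [δ_n, 0], …, [δ₁, 0]` of the nested product. -/
def nestedFactor (n i : ℕ) : Doubled :=
  if i < n then pair 0 (kron (i + 1)) else pair (kron ((2 * n - i : ℕ) : ℤ)) 0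

theorem efpObservable_eq_fieldProd_nested (n : ℕ) :
    efpObservable n = fieldProd fun i : Fin (2 * n) => nestedFactor n i := by
  rw [efpObservable_eq_mul_star, star_annihProd, fieldProd_eq_prod_map, two_mul, List.range_add,
    List.map_append, List.prod_append, annihProd, List.map_map]
  congr 2
  · refine List.map_congr_left fun i hi => ?_
    rw [nestedFactor, if_pos (List.mem_range.1 hi), annihGen]
  · refine List.map_congr_left fun i hi => ?_
    rw [Function.comp_apply, nestedFactor, if_neg (by omega), star_annihGen]
    congr 4
    omega

open MeasureTheory Filter Topology

/-! ### The momentum representation -/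

instance fact_two_pi_pos : Fact (0 < 2 * Real.pi) := ⟨Real.two_pi_pos⟩

/-- Momentum space, the circle `ℝ / 2πℤ`. -/
abbrev Torus : Type := AddCircle (2 * Real.pi)

/-- The normalized Haar measure `dk / 2π` on momentum space. -/
abbrev haar : Measure Torus := AddCircle.haarAddCircle

/-- The sequence of Fourier coefficients of a continuous function on momentum space, an isometry
for the `L²`-norm. -/
def fourierSeq : C(Torus, ℂ) →L[ℂ] OneParticle :=
  (fourierBasis.repr.toContinuousLinearEquiv :
      Lp ℂ 2 haar ≃L[ℂ] OneParticle).toContinuousLinearMap ∘L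
    ContinuousMap.toLp 2 haar ℂ

theorem fourierSeq_eq_repr (g : C(Torus, ℂ)) :
    fourierSeq g = fourierBasis.repr (ContinuousMap.toLp 2 haar ℂ g) := rfl

theorem fourierSeq_apply (g : C(Torus, ℂ)) (x : ℤ) : fourierSeq g x = fourierCoeff g x := by
  rw [fourierSeq_eq_repr, fourierBasis_repr, fourierCoeff_toLp]

theorem inner_fourierSeq (f g : C(Torus, ℂ)) :
    inner ℂ (fourierSeq f) (fourierSeq g) = ∫ k, g k * (starRingEnd ℂ) (f k) ∂haar := by
  rw [fourierSeq_eq_repr, fourierSeq_eq_repr, LinearIsometryEquiv.inner_map_map,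
    ContinuousMap.inner_toLp]

theorem fourierSeq_injective : Function.Injective fourierSeq := by
  intro f g h
  rw [fourierSeq_eq_repr, fourierSeq_eq_repr] at h
  exact ContinuousMap.toLp_injective haar (fourierBasis.repr.injective h)

theorem fourierSeq_fourier (x : ℤ) : fourierSeq (fourier x) = kron x := by
  apply lp.ext
  funext y
  rw [fourierSeq_apply, kron_apply, fourierCoeff_fourier, Pi.single_apply]

theorem fourierSeq_fourier_mul (n x : ℤ) (g : C(Torus, ℂ)) :
    fourierSeq (fourier n * g) x = fourierSeq g (x - n) := by
  rw [fourierSeq_apply, fourierSeq_apply, fourierCoeff, fourierCoeff]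
  refine integral_congr_ae (.of_forall fun k => ?_)
  simp only [ContinuousMap.mul_apply, smul_eq_mul]
  rw [← mul_assoc, ← fourier_add]
  congr 3
  ring

theorem inner_kron_left {ι : Type} [DecidableEq ι] (i : ι) (f : L2 ι) :
    inner ℂ (kron i) f = f i := by
  rw [kron, lp.inner_single_left]
  simp

theorem shift_apply (f : OneParticle) (x : ℤ) : shift f x = f (x - 1) := by
  simp [shift]

theorem shift_kron (x : ℤ) : shift (kron x) = kron (x + 1) := by
  simpa using shift_pow_kron 1 x

theorem star_shift_apply (f : OneParticle) (x : ℤ) : (star shift) f x = f (x + 1) := by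
  rw [← inner_kron_left, ContinuousLinearMap.star_eq_adjoint,
    ContinuousLinearMap.adjoint_inner_right, shift_kron, inner_kron_left]

theorem ham_apply (lam : ℝ) (f : OneParticle) (x : ℤ) :
    ham lam f x = 2⁻¹ * (f (x - 1) + f (x + 1)) + lam * f x := by
  show (2⁻¹ : ℂ) * (shift f x + (star shift) f x) + (lam : ℂ) * f x = _
  rw [shift_apply, star_shift_apply]

/-- The dispersion relation `k ↦ λ + cos k`. -/
def energy (lam : ℝ) : C(Torus, ℂ) :=
  (2⁻¹ : ℂ) • (fourier 1 + fourier (-1)) + (lam : ℂ) • 1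

theorem energy_apply (lam : ℝ) (k : Torus) :
    energy lam k = ((lam + (k.toCircle : ℂ).re : ℝ) : ℂ) := by
  have h := Complex.add_conj (k.toCircle : ℂ)
  simp only [energy, ContinuousMap.add_apply, ContinuousMap.smul_apply, ContinuousMap.one_apply,
    smul_eq_mul, fourier_neg, fourier_one, h]
  push_cast
  ring

theorem ham_fourierSeq (lam : ℝ) (g : C(Torus, ℂ)) :
    ham lam (fourierSeq g) = fourierSeq (energy lam * g) := by
  apply lp.ext
  funext x
  have h : energy lam * g = (2⁻¹ : ℂ) • (fourier 1 * g + fourier (-1) * g) + (lam : ℂ) • g := by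
    ext k
    simp [energy]
    ring
  rw [ham_apply, h, map_add, map_smul, map_smul, map_add]
  show _ = (2⁻¹ : ℂ) * (fourierSeq (fourier 1 * g) x + fourierSeq (fourier (-1) * g) x)
    + (lam : ℂ) * fourierSeq g x
  rw [fourierSeq_fourier_mul, fourierSeq_fourier_mul, sub_neg_eq_add]

/-- If `V` intertwines the operator `H` with the multiplication by `a` on a Banach algebra, then it
intertwines the exponentials. -/
theorem exp_apply_of_intertwines {A E : Type*} [NormedRing A] [NormedAlgebra ℂ A]
    [CompleteSpace A] [NormedAddCommGroup E] [NormedSpace ℂ E] [CompleteSpace E]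
    (H : E →L[ℂ] E) (V : A →L[ℂ] E) (a : A) (h : ∀ g, H (V g) = V (a * g)) (g : A) :
    NormedSpace.exp H (V g) = V (NormedSpace.exp a * g) := by
  have hpow : ∀ n : ℕ, (H ^ n) (V g) = V (a ^ n * g) := fun n => by
    induction n with
    | zero => simp
    | succ n ih => rw [pow_succ', mul_apply_eq_comp, ih, h, pow_succ', mul_assoc]
  have h1 := (NormedSpace.exp_series_hasSum_exp' (𝕂 := ℂ) H).mapL
    (ContinuousLinearMap.apply ℂ E (V g))
  have h2 := ((NormedSpace.exp_series_hasSum_exp' (𝕂 := ℂ) a).mul_right g).mapL V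
  refine h1.unique (h2.congr_fun ?_)
  intro n
  simp [hpow]

/-- The multiplier `k ↦ e^{it(λ + cos k)}` of the time evolution. -/
def phase (lam t : ℝ) : C(Torus, ℂ) := NormedSpace.exp ((Complex.I * t) • energy lam)

theorem phase_apply (lam t : ℝ) (k : Torus) :
    phase lam t k = Complex.exp ((t * (lam + (k.toCircle : ℂ).re) : ℝ) * Complex.I) := by
  rw [phase, NormedSpace.exp_continuousMap_eq, ContinuousMap.coe_mk, Function.comp_apply,
    ContinuousMap.smul_apply, energy_apply, Complex.exp_eq_exp_ℂ]
  congr 1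
  push_cast
  rw [smul_eq_mul]
  ring

theorem norm_phase (lam t : ℝ) (k : Torus) : ‖phase lam t k‖ = 1 := by
  rw [phase_apply, Complex.norm_exp_ofReal_mul_I]

/-- The wave packet at time `t` with initial momentum amplitude `g`. -/
def packet (lam t : ℝ) (g : C(Torus, ℂ)) : OneParticle := fourierSeq (phase lam t * g)

theorem exp_ham_fourierSeq (lam t : ℝ) (g : C(Torus, ℂ)) :
    NormedSpace.exp ((Complex.I * t) • ham lam) (fourierSeq g) = packet lam t g := by
  refine exp_apply_of_intertwines _ fourierSeq _ (fun g => ?_) g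
  rw [smul_mul_assoc, map_smul, ← ham_fourierSeq]
  rfl

theorem inner_packet (lam t : ℝ) (f g : C(Torus, ℂ)) :
    inner ℂ (packet lam t f) (packet lam t g) = inner ℂ (fourierSeq f) (fourierSeq g) := by
  rw [packet, packet, inner_fourierSeq, inner_fourierSeq]
  refine integral_congr_ae (.of_forall fun k => ?_)
  have h := Complex.mul_conj (phase lam t k)
  rw [Complex.normSq_eq_norm_sq, norm_phase, one_pow, Complex.ofReal_one] at h
  simp only [ContinuousMap.mul_apply, map_mul]
  linear_combination (g k * (starRingEnd ℂ) (f k)) * h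

theorem norm_packet (lam t : ℝ) (g : C(Torus, ℂ)) : ‖packet lam t g‖ = ‖fourierSeq g‖ := by
  rw [@norm_eq_sqrt_re_inner ℂ, inner_packet, ← @norm_eq_sqrt_re_inner ℂ]

theorem packet_add (lam t : ℝ) (f g : C(Torus, ℂ)) :
    packet lam t (f + g) = packet lam t f + packet lam t g := by
  rw [packet, mul_add, map_add]; rfl

theorem packet_smul (lam t : ℝ) (c : ℂ) (g : C(Torus, ℂ)) :
    packet lam t (c • g) = c • packet lam t g := by
  rw [packet, mul_smul_comm, map_smul]; rfl

theorem ham_packet (lam t : ℝ) (g : C(Torus, ℂ)) :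
    ham lam (packet lam t g) = packet lam t (energy lam * g) := by
  rw [packet, ham_fourierSeq, packet, mul_left_comm]

/-! ### Ballistic propagation -/

/-- The probability distribution of the position in the unit vector `f`. -/
def positionPMF (f : OneParticle) (hf : ‖f‖ = 1) : PMF ℤ :=
  ⟨fun x => ENNReal.ofReal (‖f x‖ ^ 2), by
    have h := lp.hasSum_norm (p := 2) (by norm_num) f
    simp only [hf, ENNReal.toReal_ofNat, Real.rpow_two, one_pow] at h
    rw [ENNReal.summable.hasSum_iff,
      ← ENNReal.ofReal_tsum_of_nonneg (fun _ => sq_nonneg _) h.summable, h.tsum_eq,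
      ENNReal.ofReal_one]⟩

theorem integral_positionPMF (f : OneParticle) (hf : ‖f‖ = 1) (w : ℤ → ℂ) (C : ℝ)
    (hw : ∀ x, ‖w x‖ ≤ C) :
    ∫ x, w x ∂(positionPMF f hf).toMeasure = ∑' x, inner ℂ (f x) (w x * f x) := by
  rw [PMF.integral_eq_tsum]
  · refine tsum_congr fun x => ?_
    have h : (positionPMF f hf x).toReal = ‖f x‖ ^ 2 :=
      ENNReal.toReal_ofReal (sq_nonneg _)
    have h2 := Complex.mul_conj (f x)
    rw [Complex.normSq_eq_norm_sq] at h2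
    rw [h, Complex.real_smul, ← h2, RCLike.inner_apply]
    ring
  · exact Integrable.of_bound Measurable.of_discrete.aestronglyMeasurable C (.of_forall hw)

/-- The distribution of `(x - y) / t` in the unit vector `f`, for the position `x`. -/
def velocityLaw (f : OneParticle) (hf : ‖f‖ = 1) (y : ℤ) (t : ℝ) : ProbabilityMeasure ℝ :=
  ⟨(positionPMF f hf).toMeasure.map fun x : ℤ => ((x - y : ℤ) : ℝ) / t,
    Measure.isProbabilityMeasure_map Measurable.of_discrete.aemeasurable⟩

/-- The translate `k ↦ g(k + a)`. -/
def translate (a : ℝ) (g : C(Torus, ℂ)) : C(Torus, ℂ) :=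
  g.comp ⟨fun k => k + (a : Torus), by fun_prop⟩

theorem fourier_coe_real (x : ℤ) (a : ℝ) :
    fourier x (a : Torus) = Complex.exp ((a * x : ℝ) * Complex.I) := by
  rw [fourier_coe_apply]
  congr 1
  push_cast
  field_simp

theorem fourierSeq_translate (a : ℝ) (g : C(Torus, ℂ)) (x : ℤ) :
    fourierSeq (translate a g) x
      = Complex.exp ((a * x : ℝ) * Complex.I) * fourierSeq g x := by
  rw [fourierSeq_apply, fourierSeq_apply, fourierCoeff, fourierCoeff, ← integral_const_mul,
    ← integral_add_right_eq_self (fun k => _ * (fourier (-x) k • g k)) (a : Torus),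
    ← fourier_coe_real]
  refine integral_congr_ae (.of_forall fun k => ?_)
  have h : fourier (-x) (k + (a : Torus)) = fourier (-x) k * fourier (-x) (a : Torus) := by
    simp only [fourier_apply, smul_add, AddCircle.toCircle_add, Circle.coe_mul]
  have h2 : fourier x (a : Torus) * fourier (-x) (a : Torus) = 1 := by
    rw [← fourier_add]; simp
  simp only [translate, ContinuousMap.comp_apply, ContinuousMap.coe_mk, smul_eq_mul, h]
  linear_combination (-(fourier (-x) k * g (k + (a : Torus)))) * h2

/-- Translations in momentum space are the phases in position space, so that the characteristic
function of the velocity is an overlap of the amplitude with its translate. -/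
theorem charFun_velocityLaw (g : C(Torus, ℂ)) (hg : ‖fourierSeq g‖ = 1) (y : ℤ) (t s : ℝ) :
    charFun (velocityLaw (fourierSeq g) hg y t : Measure ℝ) s =
      Complex.exp ((-(s / t * y) : ℝ) * Complex.I) *
        ∫ k, translate (s / t) g k * (starRingEnd ℂ) (g k) ∂haar := by
  rw [← inner_fourierSeq, charFun_apply_real]
  show ∫ v, _ ∂((positionPMF (fourierSeq g) hg).toMeasure.map _) = _
  rw [integral_map Measurable.of_discrete.aemeasurable (by fun_prop)]
  have hexp : ∀ x : ℤ, Complex.exp (s * ((((x - y : ℤ) : ℝ) / t : ℝ) : ℂ) * Complex.I)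
      = Complex.exp ((-(s / t * y) : ℝ) * Complex.I)
        * Complex.exp ((s / t * x : ℝ) * Complex.I) := fun x => by
    rw [← Complex.exp_add]
    congr 1
    push_cast
    ring
  rw [integral_positionPMF _ _ _ 1, lp.inner_eq_tsum, ← tsum_mul_left]
  · refine tsum_congr fun x => ?_
    rw [fourierSeq_translate, hexp]
    simp only [RCLike.inner_apply]
    ring
  · intro x
    rw [hexp, norm_mul, Complex.norm_exp_ofReal_mul_I, Complex.norm_exp_ofReal_mul_I, one_mul]

theorem toCircle_coe_real (a : ℝ) :
    (AddCircle.toCircle (a : Torus) : ℂ) = Complex.exp (a * Complex.I) := by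
  rw [AddCircle.toCircle_apply_mk, Circle.coe_exp]
  congr 2
  push_cast
  field_simp

theorem re_toCircle_add (k : Torus) (a : ℝ) :
    (AddCircle.toCircle (k + (a : Torus)) : ℂ).re =
      (k.toCircle : ℂ).re * Real.cos a - (k.toCircle : ℂ).im * Real.sin a := by
  rw [AddCircle.toCircle_add, Circle.coe_mul, toCircle_coe_real, Complex.mul_re,
    Complex.exp_ofReal_mul_I_re, Complex.exp_ofReal_mul_I_im]

/-- The phase velocity: `t (cos(k + s/t) - cos k) → -s sin k`. -/
theorem tendsto_mul_re_toCircle_sub (k : Torus) (s : ℝ) :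
    Tendsto (fun t : ℝ => t * ((AddCircle.toCircle (k + ((s / t : ℝ) : Torus)) : ℂ).re
      - (k.toCircle : ℂ).re)) atTop (𝓝 (-(s * (k.toCircle : ℂ).im))) := by
  have hd : HasDerivAt (fun a => (k.toCircle : ℂ).re * Real.cos a
      - (k.toCircle : ℂ).im * Real.sin a) (-(k.toCircle : ℂ).im) 0 := by
    have h := ((Real.hasDerivAt_cos 0).const_mul (k.toCircle : ℂ).re).sub
      ((Real.hasDerivAt_sin 0).const_mul (k.toCircle : ℂ).im)
    simp only [Real.sin_zero, Real.cos_zero, neg_zero, mul_zero, mul_one, zero_sub] at h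
    exact h
  have h := hd.hasFDerivAt.lim s tendsto_norm_atTop_atTop
  have he : (ContinuousLinearMap.toSpanSingleton ℝ (-(k.toCircle : ℂ).im)) s
      = -(s * (k.toCircle : ℂ).im) := by simp
  rw [← he]
  refine h.congr fun t => ?_
  rw [re_toCircle_add]
  simp [div_eq_inv_mul]

theorem measurable_im_toCircle : Measurable fun k : Torus => (k.toCircle : ℂ).im :=
  (Complex.continuous_im.comp
    (continuous_subtype_val.comp AddCircle.continuous_toCircle)).measurable

/-- The distribution of the group velocity `-sin k` in the momentum amplitude `g`. -/
def asymptoticVelocityLaw (g : C(Torus, ℂ)) (hg : ‖fourierSeq g‖ = 1) : ProbabilityMeasure ℝ :=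
  ⟨(haar.withDensity fun k => ENNReal.ofReal (‖g k‖ ^ 2)).map fun k => -(k.toCircle : ℂ).im, by
    have h : IsProbabilityMeasure (haar.withDensity fun k => ENNReal.ofReal (‖g k‖ ^ 2)) := by
      refine ⟨?_⟩
      rw [withDensity_apply _ MeasurableSet.univ, setLIntegral_univ,
        ← ofReal_integral_eq_lintegral_ofReal]
      · have h1 := inner_fourierSeq g g
        rw [inner_self_eq_norm_sq_to_K, hg] at h1
        have h2 : ∀ k, g k * (starRingEnd ℂ) (g k) = ((‖g k‖ ^ 2 : ℝ) : ℂ) := fun k => by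
          rw [Complex.mul_conj, Complex.normSq_eq_norm_sq]
        simp only [h2, integral_complex_ofReal] at h1
        have h3 : ∫ k, ‖g k‖ ^ 2 ∂haar = 1 := by
          have h4 : ((∫ k, ‖g k‖ ^ 2 ∂haar : ℝ) : ℂ) = ((1 : ℝ) : ℂ) := by rw [← h1]; simp
          exact_mod_cast h4
        rw [h3, ENNReal.ofReal_one]
      · exact (by fun_prop : Continuous fun k => ‖g k‖ ^ 2).integrable_of_hasCompactSupport
          (HasCompactSupport.of_compactSpace _)
      · exact .of_forall fun _ => sq_nonneg _
    exact Measure.isProbabilityMeasure_map measurable_im_toCircle.neg.aemeasurable⟩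

theorem charFun_asymptoticVelocityLaw (g : C(Torus, ℂ)) (hg : ‖fourierSeq g‖ = 1) (s : ℝ) :
    charFun (asymptoticVelocityLaw g hg : Measure ℝ) s =
      ∫ k, Complex.exp ((-(s * (k.toCircle : ℂ).im) : ℝ) * Complex.I) *
        (g k * (starRingEnd ℂ) (g k)) ∂haar := by
  rw [charFun_apply_real]
  show ∫ v, _ ∂((haar.withDensity _).map _) = _
  have hm : Measurable fun k : Torus => -(k.toCircle : ℂ).im := measurable_im_toCircle.neg
  rw [integral_map hm.aemeasurable (by fun_prop),
    integral_withDensity_eq_integral_toReal_smul (by fun_prop) (.of_forall fun _ => by simp)]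
  refine integral_congr_ae (.of_forall fun k => ?_)
  simp only
  rw [ENNReal.toReal_ofReal (sq_nonneg _), Complex.mul_conj, Complex.normSq_eq_norm_sq,
    Complex.real_smul, mul_comm]
  congr 2
  push_cast
  ring

theorem norm_fourierSeq_phase_mul (lam t : ℝ) {g : C(Torus, ℂ)} (hg : ‖fourierSeq g‖ = 1) :
    ‖fourierSeq (phase lam t * g)‖ = 1 := (norm_packet lam t g).trans hg

/-- Dominated convergence in the overlap integral: `e^{it cos k}` turns the translation by `s / t`
into the phase `e^{-is sin k}` as `t → ∞`. -/
theorem tendsto_charFun_velocityLaw (lam : ℝ) (g : C(Torus, ℂ)) (hg : ‖fourierSeq g‖ = 1)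
    (y : ℤ) (s : ℝ) :
    Tendsto (fun t => charFun (velocityLaw (fourierSeq (phase lam t * g))
        (norm_fourierSeq_phase_mul lam t hg) y t : Measure ℝ) s) atTop
      (𝓝 (charFun (asymptoticVelocityLaw g hg : Measure ℝ) s)) := by
  have hst : Tendsto (fun t : ℝ => s / t) atTop (𝓝 0) := tendsto_const_nhds.div_atTop tendsto_id
  simp only [charFun_velocityLaw, charFun_asymptoticVelocityLaw]
  rw [← one_mul (∫ k, _ ∂haar)]
  refine Tendsto.mul ?_ ?_
  · have h : Tendsto (fun t : ℝ => Complex.exp ((-(s / t * y) : ℝ) * Complex.I)) atTop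
        (𝓝 (Complex.exp ((-(0 * y) : ℝ) * Complex.I))) :=
      ((by fun_prop : Continuous fun a : ℝ => Complex.exp ((-(a * y) : ℝ) * Complex.I)).tendsto
        0).comp hst
    simpa using h
  · refine tendsto_integral_filter_of_dominated_convergence (fun _ => ‖g‖ * ‖g‖) ?_ ?_ ?_ ?_
    · refine .of_forall fun t => Continuous.aestronglyMeasurable ?_
      exact (ContinuousMap.continuous _).mul (Complex.continuous_conj.comp (map_continuous _))
    · refine .of_forall fun t => .of_forall fun k => ?_
      simp only [translate, ContinuousMap.comp_apply, ContinuousMap.mul_apply, norm_mul, map_mul,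
        norm_phase, one_mul, RCLike.norm_conj]
      exact mul_le_mul (g.norm_coe_le_norm _) (g.norm_coe_le_norm _) (norm_nonneg _)
        (norm_nonneg _)
    · exact integrable_const _
    · refine .of_forall fun k => ?_
      have hk : Tendsto (fun t : ℝ => g (k + ((s / t : ℝ) : Torus))) atTop (𝓝 (g k)) := by
        have hc : Continuous fun a : ℝ => g (k + (a : Torus)) := by fun_prop
        have h := (hc.tendsto 0).comp hst
        rw [AddCircle.coe_zero, add_zero] at h
        exact h
      have hphase : ∀ t : ℝ, translate (s / t) (phase lam t * g) k *
          (starRingEnd ℂ) ((phase lam t * g) k) =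
          Complex.exp ((t * ((AddCircle.toCircle (k + ((s / t : ℝ) : Torus)) : ℂ).re
            - (k.toCircle : ℂ).re) : ℝ) * Complex.I) *
          (g (k + ((s / t : ℝ) : Torus)) * (starRingEnd ℂ) (g k)) := fun t => by
        simp only [translate, ContinuousMap.comp_apply, ContinuousMap.mul_apply, map_mul,
          ContinuousMap.coe_mk, phase_apply, ← Complex.exp_conj, Complex.conj_ofReal,
          Complex.conj_I]
        rw [mul_mul_mul_comm, ← Complex.exp_add]
        congr 2
        push_cast
        ring
      simp only [hphase]
      refine Tendsto.mul ?_ (hk.mul tendsto_const_nhds)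
      exact ((by fun_prop : Continuous fun a : ℝ => Complex.exp ((a : ℂ) * Complex.I)).tendsto
        _).comp (tendsto_mul_re_toCircle_sub k s)

/-- The position divided by the time converges in law to the group velocity. -/
theorem tendsto_velocityLaw (lam : ℝ) (g : C(Torus, ℂ)) (hg : ‖fourierSeq g‖ = 1) (y : ℤ) :
    Tendsto (fun t => velocityLaw (fourierSeq (phase lam t * g))
        (norm_fourierSeq_phase_mul lam t hg) y t) atTop (𝓝 (asymptoticVelocityLaw g hg)) :=
  tendsto_of_seq_tendsto fun _ hu => ProbabilityMeasure.tendsto_of_tendsto_charFun fun s =>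
    (tendsto_charFun_velocityLaw lam g hg y s).comp hu

instance nullSingletonClass_haar : NullSingletonClass haar :=
  have : Nontrivial Torus := ⟨⟨(0 : Torus), (Real.pi : Torus), fun h => by
    have h2 := congrArg (fun z : Torus => (z.toCircle : ℂ)) h
    simp only [AddCircle.toCircle_zero, toCircle_coe_real, Complex.exp_pi_mul_I] at h2
    norm_num at h2⟩⟩
  have := ConnectedSpace.neBot_nhdsWithin_compl_of_nontrivial_of_t1space (0 : Torus)
  inferInstance

/-- The critical points of the dispersion relation form a null set. -/
theorem haar_im_toCircle_eq_zero : haar {k | (k.toCircle : ℂ).im = 0} = 0 := by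
  have hinj : Function.Injective fun k : Torus => (k.toCircle : ℂ) :=
    Subtype.val_injective.comp (AddCircle.injective_toCircle Real.two_pi_pos.ne')
  have hfin : ({k | (k.toCircle : ℂ).im = 0} : Set Torus).Finite := by
    refine Set.Finite.subset (Set.Finite.preimage hinj.injOn (Set.toFinite {1, -1})) ?_
    intro k hk
    have h1 := Circle.normSq_coe k.toCircle
    rw [Complex.normSq_apply, show (k.toCircle : ℂ).im = 0 from hk, mul_zero, add_zero,
      mul_self_eq_one_iff] at h1
    rcases h1 with h1 | h1
    · exact Or.inl (Complex.ext h1 (by simpa using hk))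
    · exact Or.inr (Complex.ext (by simpa using h1) (by simpa using hk))
  exact hfin.measure_zero _

/-- The half-line `x ≤ y` is the event that the velocity `(x - y) / t` is nonpositive, and the limit
law of the velocity does not charge the boundary point `0`. -/
theorem tendsto_positionPMF (lam : ℝ) (g : C(Torus, ℂ)) (hg : ‖fourierSeq g‖ = 1) (y : ℤ) :
    Tendsto (fun t => (positionPMF (fourierSeq (phase lam t * g))
        (norm_fourierSeq_phase_mul lam t hg)).toMeasure.real {x | x ≤ y}) atTop
      (𝓝 (∫ k in {k | 0 ≤ (k.toCircle : ℂ).im}, ‖g k‖ ^ 2 ∂haar)) := by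
  have hm : Measurable fun k : Torus => -(k.toCircle : ℂ).im := measurable_im_toCircle.neg
  have hnull : (asymptoticVelocityLaw g hg : Measure ℝ) (frontier (Set.Iic 0)) = 0 := by
    rw [frontier_Iic]
    show ((haar.withDensity _).map _) _ = 0
    rw [Measure.map_apply hm (measurableSet_singleton 0)]
    refine withDensity_absolutelyContinuous _ _ ?_
    simpa [Set.preimage] using haar_im_toCircle_eq_zero
  have h := ProbabilityMeasure.tendsto_measure_of_null_frontier_of_tendsto'
    (tendsto_velocityLaw lam g hg y) hnull
  have h2 := (ENNReal.tendsto_toReal (measure_ne_top _ _)).comp h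
  have hlim : ((asymptoticVelocityLaw g hg : Measure ℝ) (Set.Iic 0)).toReal
      = ∫ k in {k | 0 ≤ (k.toCircle : ℂ).im}, ‖g k‖ ^ 2 ∂haar := by
    show (((haar.withDensity _).map _) _).toReal = _
    have hset : (fun k : Torus => -(k.toCircle : ℂ).im) ⁻¹' Set.Iic 0
        = {k | 0 ≤ (k.toCircle : ℂ).im} := by ext k; simp
    rw [Measure.map_apply hm measurableSet_Iic, withDensity_apply _ (hm measurableSet_Iic), hset,
      integral_eq_lintegral_of_nonneg_ae (.of_forall fun _ => sq_nonneg _)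
        (by fun_prop : Continuous fun k => ‖g k‖ ^ 2).aestronglyMeasurable]
  rw [← hlim]
  refine h2.congr' ?_
  filter_upwards [eventually_gt_atTop 0] with t ht
  show (((positionPMF _ _).toMeasure.map _) _).toReal = (_ : ENNReal).toReal
  rw [Measure.map_apply Measurable.of_discrete measurableSet_Iic]
  congr 2
  ext x
  simp only [Set.mem_preimage, Set.mem_Iic, Set.mem_ofPred_eq]
  rw [div_le_iff₀ ht, zero_mul]
  exact_mod_cast sub_nonpos

theorem coordProj_apply (X : Set ℤ) [DecidablePred (· ∈ X)] (f : OneParticle) (x : ℤ) :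
    coordProj X f x = if x ∈ X then f x else 0 := by
  simp [coordProj]

theorem real_positionPMF (f : OneParticle) (hf : ‖f‖ = 1) (X : Set ℤ) [DecidablePred (· ∈ X)] :
    (((positionPMF f hf).toMeasure.real X : ℝ) : ℂ) = inner ℂ f (coordProj X f) := by
  have h := integral_positionPMF f hf (X.indicator fun _ => 1) 1 fun x => by
    by_cases hx : x ∈ X <;> simp [hx]
  rw [integral_indicator_const _ MeasurableSet.of_discrete, Complex.real_smul, mul_one] at h
  rw [h, lp.inner_eq_tsum]
  refine tsum_congr fun x => ?_
  rw [coordProj_apply]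
  by_cases hx : x ∈ X <;> simp [hx]

/-- The part of a wave packet to the left of a fixed site consists asymptotically of the momenta
with a nonpositive group velocity `-sin k`. -/
theorem tendsto_inner_packet_coordProj_self (lam : ℝ) (g : C(Torus, ℂ)) (y : ℤ) :
    Tendsto (fun t => inner ℂ (packet lam t g) (coordProj {x | x ≤ y} (packet lam t g))) atTop
      (𝓝 (∫ k in {k | 0 ≤ (k.toCircle : ℂ).im}, g k * (starRingEnd ℂ) (g k) ∂haar)) := by
  by_cases hg0 : ‖fourierSeq g‖ = 0
  · have hg : g = 0 := fourierSeq_injective (by rw [norm_eq_zero.1 hg0, map_zero])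
    subst hg
    simp [packet]
  -- the laws are defined for unit vectors, and both sides are quadratic in `g`
  · set c : ℝ := ‖fourierSeq g‖ with hc
    have hcC : (c : ℂ) ≠ 0 := by exact_mod_cast hg0
    obtain ⟨g', hg'⟩ : ∃ g', g = (c : ℂ) • g' := ⟨(c : ℂ)⁻¹ • g, by rw [smul_inv_smul₀ hcC]⟩
    have hn : ‖fourierSeq g'‖ = 1 := by
      have h1 : c = |c| * ‖fourierSeq g'‖ := by
        conv_lhs => rw [hc, hg', map_smul, norm_smul, Complex.norm_real, Real.norm_eq_abs]
      rw [abs_of_nonneg (norm_nonneg _)] at h1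
      exact mul_left_cancel₀ hg0 (by linarith)
    have h := (Complex.continuous_ofReal.tendsto _).comp (tendsto_positionPMF lam g' hn y)
    have h2 := h.const_mul ((c : ℂ) * c)
    rw [← integral_complex_ofReal, ← integral_const_mul] at h2
    convert h2 using 1
    · funext t
      rw [Function.comp_apply, real_positionPMF, hg', packet_smul, map_smul, inner_smul_left,
        inner_smul_right, Complex.conj_ofReal, ← mul_assoc]
      rfl
    · congr 1
      refine integral_congr_ae (.of_forall fun k => ?_)
      simp only [hg', ContinuousMap.smul_apply, smul_eq_mul, map_mul, Complex.conj_ofReal,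
        Complex.ofReal_pow, ← Complex.mul_conj']
      ring

/-! ### Laurent operators -/

/-- The Laurent operator on `ℓ²(ℤ)`: multiplication by an essentially bounded function in the
momentum representation. -/
def laurent (s : Torus → ℂ) (hs : MemLp s ⊤ haar) : OneParticle →L[ℂ] OneParticle :=
  (fourierBasis.repr.toContinuousLinearEquiv :
      Lp ℂ 2 haar ≃L[ℂ] OneParticle).toContinuousLinearMap ∘L
    (ContinuousLinearMap.mul ℂ ℂ).holderL haar ⊤ 2 2 (hs.toLp s) ∘L
    (fourierBasis.repr.symm.toContinuousLinearEquiv :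
      OneParticle ≃L[ℂ] Lp ℂ 2 haar).toContinuousLinearMap

theorem inner_laurent (s : Torus → ℂ) (hs : MemLp s ⊤ haar) (f g : C(Torus, ℂ)) :
    inner ℂ (fourierSeq f) (laurent s hs (fourierSeq g)) =
      ∫ k, s k * (g k * (starRingEnd ℂ) (f k)) ∂haar := by
  have h1 : laurent s hs (fourierSeq g) = fourierBasis.repr
      ((ContinuousLinearMap.mul ℂ ℂ).holder 2 (hs.toLp s) (ContinuousMap.toLp 2 haar ℂ g)) := by
    show fourierBasis.repr ((ContinuousLinearMap.mul ℂ ℂ).holder 2 (hs.toLp s)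
      (fourierBasis.repr.symm (fourierSeq g))) = _
    rw [fourierSeq_eq_repr, LinearIsometryEquiv.symm_apply_apply]
  rw [h1, fourierSeq_eq_repr, LinearIsometryEquiv.inner_map_map, L2.inner_def]
  refine integral_congr_ae ?_
  filter_upwards [ContinuousMap.coeFn_toLp haar (𝕜 := ℂ) (p := 2) f,
    ContinuousMap.coeFn_toLp haar (𝕜 := ℂ) (p := 2) g, hs.coeFn_toLp,
    (ContinuousLinearMap.mul ℂ ℂ).coeFn_holder (r := 2) (hs.toLp s)
      (ContinuousMap.toLp 2 haar ℂ g)] with k hf hg hk hh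
  rw [hh, hf, hg, hk, RCLike.inner_apply]
  simp [mul_assoc]

theorem laurent_kron_apply (s : Torus → ℂ) (hs : MemLp s ⊤ haar) (i j : ℤ) :
    laurent s hs (kron j) i = fourierCoeff s (i - j) := by
  rw [← inner_kron_left, ← fourierSeq_fourier, ← fourierSeq_fourier, inner_laurent, fourierCoeff]
  refine integral_congr_ae (.of_forall fun k => ?_)
  simp only [← fourier_neg, smul_eq_mul]
  rw [← fourier_add, mul_comm]
  congr 3
  ring

/-! ### Asymptotics of wave packets -/

/-- The characteristic function of the momenta with a nonpositive group velocity `-sin k`. -/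
def leftMovers : Torus → ℂ := {k : Torus | 0 ≤ (k.toCircle : ℂ).im}.indicator fun _ => 1

theorem measurableSet_leftMovers : MeasurableSet {k : Torus | 0 ≤ (k.toCircle : ℂ).im} :=
  measurable_im_toCircle measurableSet_Ici

theorem memLp_leftMovers : MemLp leftMovers ⊤ haar :=
  memLp_top_of_bound
    (measurable_const.indicator measurableSet_leftMovers).aestronglyMeasurable 1
    (.of_forall fun k => by
      unfold leftMovers
      by_cases h : k ∈ {k : Torus | 0 ≤ (k.toCircle : ℂ).im} <;> simp [h])

/-- By polarization, convergence of the quadratic forms on the range of `fourierSeq` implies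
convergence of the sesquilinear forms. -/
theorem tendsto_inner_of_quadratic {A : ℝ → OneParticle →L[ℂ] OneParticle}
    {A' : OneParticle →L[ℂ] OneParticle}
    (h : ∀ g, Tendsto (fun t => inner ℂ (fourierSeq g) (A t (fourierSeq g))) atTop
      (𝓝 (inner ℂ (fourierSeq g) (A' (fourierSeq g))))) (f g : C(Torus, ℂ)) :
    Tendsto (fun t => inner ℂ (fourierSeq f) (A t (fourierSeq g))) atTop
      (𝓝 (inner ℂ (fourierSeq f) (A' (fourierSeq g)))) := by
  have hpol : ∀ D : OneParticle →L[ℂ] OneParticle,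
      inner ℂ (fourierSeq f) (D (fourierSeq g)) =
      (inner ℂ (fourierSeq (g + f)) (D (fourierSeq (g + f)))
        - inner ℂ (fourierSeq (g - f)) (D (fourierSeq (g - f)))
        + Complex.I * inner ℂ (fourierSeq (g + Complex.I • f))
          (D (fourierSeq (g + Complex.I • f)))
        - Complex.I * inner ℂ (fourierSeq (g - Complex.I • f))
          (D (fourierSeq (g - Complex.I • f)))) / 4 := fun D => by
    have h1 := inner_map_polarization (ContinuousLinearMap.adjoint D).toLinearMap
      (fourierSeq g) (fourierSeq f)
    simp only [ContinuousLinearMap.coe_coe, ContinuousLinearMap.adjoint_inner_left] at h1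
    simpa only [map_add, map_sub, map_smul] using h1
  simp only [hpol]
  exact ((((h _).sub (h _)).add ((h _).const_mul _)).sub ((h _).const_mul _)).div_const _

theorem tendsto_inner_packet_coordProj (lam : ℝ) (f g : C(Torus, ℂ)) (y : ℤ) :
    Tendsto (fun t => inner ℂ (packet lam t f) (coordProj {x | x ≤ y} (packet lam t g))) atTop
      (𝓝 (∫ k, leftMovers k * (g k * (starRingEnd ℂ) (f k)) ∂haar)) := by
  rw [← inner_laurent _ memLp_leftMovers]
  let U : ℝ → OneParticle →L[ℂ] OneParticle := fun t =>
    NormedSpace.exp ((Complex.I * t) • ham lam)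
  have hU : ∀ t g, U t (fourierSeq g) = packet lam t g := fun t g => exp_ham_fourierSeq lam t g
  have hA : ∀ t f g, inner ℂ (packet lam t f) (coordProj {x | x ≤ y} (packet lam t g)) =
      inner ℂ (fourierSeq f)
        ((ContinuousLinearMap.adjoint (U t) * coordProj {x | x ≤ y} * U t) (fourierSeq g)) :=
    fun t f g => by
      simp only [mul_apply_eq_comp, ContinuousLinearMap.adjoint_inner_right, hU]
  simp only [hA]
  refine tendsto_inner_of_quadratic (fun g => ?_) f g
  simp only [← hA]
  rw [inner_laurent]
  convert tendsto_inner_packet_coordProj_self lam g y using 2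
  rw [← integral_indicator measurableSet_leftMovers]
  refine integral_congr_ae (.of_forall fun k => ?_)
  unfold leftMovers
  by_cases h : k ∈ {k : Torus | 0 ≤ (k.toCircle : ℂ).im} <;> simp [h]

/-- Wave packets leave every site: the weights of the half-lines `x ≤ y` and `x ≤ y - 1` have the
same limit. -/
theorem tendsto_packet_apply (lam : ℝ) (g : C(Torus, ℂ)) (y : ℤ) :
    Tendsto (fun t => packet lam t g y) atTop (𝓝 0) := by
  have h := (tendsto_inner_packet_coordProj lam g g y).sub
    (tendsto_inner_packet_coordProj lam g g (y - 1))
  rw [sub_self] at h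
  have hsq : ∀ t, inner ℂ (packet lam t g) (coordProj {x | x ≤ y} (packet lam t g)) -
      inner ℂ (packet lam t g) (coordProj {x | x ≤ y - 1} (packet lam t g)) =
      ((‖packet lam t g y‖ ^ 2 : ℝ) : ℂ) := fun t => by
    set f := packet lam t g
    have hd : coordProj {x | x ≤ y} f - coordProj {x | x ≤ y - 1} f = f y • kron y := by
      apply lp.ext
      funext x
      simp only [lp.coeFn_sub, Pi.sub_apply, lp.coeFn_smul, Pi.smul_apply, coordProj_apply,
        kron_apply, Set.mem_ofPred_eq, smul_eq_mul]
      rcases lt_trichotomy x y with hx | rfl | hx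
      · simp [hx.le, hx.ne, Int.le_sub_one_of_lt hx]
      · simp
      · simp [hx.not_ge, hx.ne', show ¬ x ≤ y - 1 by omega]
    rw [← inner_sub_right, hd, inner_smul_right, ← inner_conj_symm, inner_kron_left,
      Complex.mul_conj, Complex.normSq_eq_norm_sq]
  simp only [hsq] at h
  have h2 : Tendsto (fun t => ‖packet lam t g y‖ ^ 2) atTop (𝓝 0) :=
    (Complex.continuous_re.tendsto 0).comp h
  have h3 := h2.sqrt
  simp only [Real.sqrt_sq (norm_nonneg _), Real.sqrt_zero] at h3
  exact tendsto_zero_iff_norm_tendsto_zero.2 h3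

/-- The projection onto the left reservoir. -/
abbrev leftProj (N : ℕ) : OneParticle →L[ℂ] OneParticle :=
  coordProj {x | x ≤ -((N : ℤ) + 1)}

/-- The projection onto the right reservoir. -/
abbrev rightProj (N : ℕ) : OneParticle →L[ℂ] OneParticle :=
  coordProj {x | (N : ℤ) + 1 ≤ x}

/-- Outside the two reservoirs there are finitely many sites. -/
theorem sub_leftProj_sub_rightProj (N : ℕ) (f : OneParticle) :
    f - leftProj N f - rightProj N f = ∑ y ∈ Finset.Icc (-(N : ℤ)) N, f y • kron y := by
  apply lp.ext
  funext x
  rw [lp.coeFn_sum, Finset.sum_apply]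
  simp only [lp.coeFn_sub, Pi.sub_apply, lp.coeFn_smul, Pi.smul_apply, coordProj_apply,
    kron_apply, Set.mem_ofPred_eq, smul_eq_mul, mul_ite, mul_one, mul_zero, Finset.sum_ite_eq,
    Finset.mem_Icc]
  split_ifs <;> first | omega | simp

/-- On the left reservoir `k₀` is `β_L h` up to the bond that was cut at its end. -/
theorem kZero_leftProj (N : ℕ) (lam βL βR : ℝ) (f : OneParticle) :
    kZero N lam βL βR (leftProj N f) = leftProj N ((βL : ℂ) • ham lam f) -
      (βL * 2⁻¹ * f (-N)) • kron (-((N : ℤ) + 1)) := by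
  apply lp.ext
  funext x
  show (βL : ℂ) * leftProj N (ham lam (leftProj N (leftProj N f))) x +
      (βR : ℂ) * rightProj N (ham lam (rightProj N (leftProj N f))) x = _
  simp only [lp.coeFn_sub, Pi.sub_apply, lp.coeFn_smul, Pi.smul_apply, coordProj_apply, ham_apply,
    kron_apply, Set.mem_ofPred_eq, smul_eq_mul]
  by_cases h : x = -((N : ℤ) + 1)
  · subst h
    have e : -((N : ℤ) + 1) + 1 = -N := by ring
    rw [e]
    split_ifs <;> first | omega | (simp; ring)
  · split_ifs <;> first | omega | simp

/-- On the right reservoir `k₀` is `β_R h` up to the bond that was cut at its end. -/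
theorem kZero_rightProj (N : ℕ) (lam βL βR : ℝ) (f : OneParticle) :
    kZero N lam βL βR (rightProj N f) = rightProj N ((βR : ℂ) • ham lam f) -
      (βR * 2⁻¹ * f N) • kron ((N : ℤ) + 1) := by
  apply lp.ext
  funext x
  show (βL : ℂ) * leftProj N (ham lam (leftProj N (rightProj N f))) x +
      (βR : ℂ) * rightProj N (ham lam (rightProj N (rightProj N f))) x = _
  simp only [lp.coeFn_sub, Pi.sub_apply, lp.coeFn_smul, Pi.smul_apply, coordProj_apply, ham_apply,
    kron_apply, Set.mem_ofPred_eq, smul_eq_mul]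
  by_cases h : x = (N : ℤ) + 1
  · subst h
    have e : (N : ℤ) + 1 - 1 = N := by ring
    rw [e]
    split_ifs <;> first | omega | (simp; ring)
  · split_ifs <;> first | omega | simp

open Polynomial

/-- A polynomial in `k₀` acts on the part of a wave packet in a reservoir as the same polynomial in
`β_L h` or `β_R h`, up to terms that involve finitely many sites only. -/
theorem tendsto_aeval_kZero_packet (N : ℕ) (lam βL βR : ℝ) (p : ℝ[X]) (g : C(Torus, ℂ)) :
    Tendsto (fun t => aeval (kZero N lam βL βR) p (packet lam t g)
        - leftProj N (packet lam t (aeval ((βL : ℂ) • energy lam) p * g))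
        - rightProj N (packet lam t (aeval ((βR : ℂ) • energy lam) p * g))) atTop (𝓝 0) := by
  have hconst : ∀ a : ℝ, Tendsto (fun t => aeval (kZero N lam βL βR) (C a) (packet lam t g)
        - leftProj N (packet lam t (aeval ((βL : ℂ) • energy lam) (C a) * g))
        - rightProj N (packet lam t (aeval ((βR : ℂ) • energy lam) (C a) * g))) atTop
        (𝓝 0) := fun a => by
    have h : ∀ t, aeval (kZero N lam βL βR) (C a) (packet lam t g)
        - leftProj N (packet lam t (aeval ((βL : ℂ) • energy lam) (C a) * g))
        - rightProj N (packet lam t (aeval ((βR : ℂ) • energy lam) (C a) * g)) =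
        (a : ℂ) • ∑ y ∈ Finset.Icc (-(N : ℤ)) N, packet lam t g y • kron y := fun t => by
      have e1 : ∀ β : ℝ, aeval ((β : ℂ) • energy lam) (C a) * g = (a : ℂ) • g := fun β => by
        ext k; simp [Algebra.algebraMap_eq_smul_one]
      have e2 : aeval (kZero N lam βL βR) (C a) (packet lam t g) = (a : ℂ) • packet lam t g := by
        rw [aeval_C, Algebra.algebraMap_eq_smul_one]
        rfl
      rw [e1, e1, e2, packet_smul, map_smul, map_smul, ← smul_sub, ← smul_sub,
        sub_leftProj_sub_rightProj]
    simp only [h]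
    have h0 : (0 : OneParticle) =
        (a : ℂ) • ∑ y ∈ Finset.Icc (-(N : ℤ)) N, (0 : ℂ) • kron y := by simp
    rw [h0]
    exact (tendsto_finsetSum _ fun y _ =>
      (tendsto_packet_apply lam g y).smul_const (kron y)).const_smul _
  have hX : ∀ p : ℝ[X], Tendsto (fun t => aeval (kZero N lam βL βR) p (packet lam t g)
        - leftProj N (packet lam t (aeval ((βL : ℂ) • energy lam) p * g))
        - rightProj N (packet lam t (aeval ((βR : ℂ) • energy lam) p * g))) atTop (𝓝 0) →
      Tendsto (fun t => aeval (kZero N lam βL βR) (X * p) (packet lam t g)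
        - leftProj N (packet lam t (aeval ((βL : ℂ) • energy lam) (X * p) * g))
        - rightProj N (packet lam t (aeval ((βR : ℂ) • energy lam) (X * p) * g))) atTop
        (𝓝 0) := fun p hp => by
    set gL := aeval ((βL : ℂ) • energy lam) p * g with hgL
    set gR := aeval ((βR : ℂ) • energy lam) p * g with hgR
    have eX : ∀ β : ℝ, aeval ((β : ℂ) • energy lam) (X * p) * g =
        (β : ℂ) • (energy lam * (aeval ((β : ℂ) • energy lam) p * g)) := fun β => by
      rw [map_mul, aeval_X, smul_mul_assoc, smul_mul_assoc, mul_assoc]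
    have h : ∀ t, aeval (kZero N lam βL βR) (X * p) (packet lam t g)
        - leftProj N (packet lam t (aeval ((βL : ℂ) • energy lam) (X * p) * g))
        - rightProj N (packet lam t (aeval ((βR : ℂ) • energy lam) (X * p) * g)) =
        kZero N lam βL βR (aeval (kZero N lam βL βR) p (packet lam t g)
          - leftProj N (packet lam t gL) - rightProj N (packet lam t gR))
        - (βL * 2⁻¹ * packet lam t gL (-N)) • kron (-((N : ℤ) + 1))
        - (βR * 2⁻¹ * packet lam t gR N) • kron ((N : ℤ) + 1) := fun t => by
      rw [eX, eX, ← hgL, ← hgR, map_sub, map_sub, kZero_leftProj, kZero_rightProj, ham_packet,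
        ham_packet, packet_smul, packet_smul, map_mul, aeval_X, mul_apply_eq_comp]
      abel
    simp only [h]
    have h1 := ((kZero N lam βL βR).continuous.tendsto 0).comp hp
    have h2 := (((tendsto_packet_apply lam gL (-N)).const_mul (βL * 2⁻¹ : ℂ)).smul_const
      (kron (-((N : ℤ) + 1))))
    have h3 := (((tendsto_packet_apply lam gR N).const_mul (βR * 2⁻¹ : ℂ)).smul_const
      (kron ((N : ℤ) + 1)))
    simpa using (h1.sub h2).sub h3
  induction p using Polynomial.induction_on with
  | C a => exact hconst a
  | add p q hp hq =>
    have h := hp.add hq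
    rw [add_zero] at h
    refine h.congr fun t => ?_
    simp only [map_add, add_mul, packet_add, add_apply]
    abel
  | monomial n a h =>
    have e : (C a * X ^ (n + 1) : ℝ[X]) = X * (C a * X ^ n) := by ring
    rw [e]
    exact hX _ h

/-- Left movers end up in the left reservoir and carry `β_L h`, right movers end up in the right
reservoir and carry `β_R h`. -/
theorem tendsto_inner_aeval_kZero (N : ℕ) (lam βL βR : ℝ) (p : ℝ[X]) (f g : C(Torus, ℂ)) :
    Tendsto (fun t => inner ℂ (packet lam t f)
      (aeval (kZero N lam βL βR) p (packet lam t g))) atTop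
      (𝓝 (∫ k, (if 0 ≤ (k.toCircle : ℂ).im then aeval ((βL : ℂ) • energy lam) p k
        else aeval ((βR : ℂ) • energy lam) p k) * (g k * (starRingEnd ℂ) (f k)) ∂haar)) := by
  set gL := aeval ((βL : ℂ) • energy lam) p * g with hgL
  set gR := aeval ((βR : ℂ) • energy lam) p * g with hgR
  have hR : ∀ φ, rightProj N φ = φ - coordProj {x | x ≤ (N : ℤ)} φ := fun φ => by
    apply lp.ext
    funext x
    simp only [lp.coeFn_sub, Pi.sub_apply, coordProj_apply, Set.mem_ofPred_eq]
    split_ifs <;> first | omega | simp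
  set r : ℝ → OneParticle := fun t => aeval (kZero N lam βL βR) p (packet lam t g)
    - leftProj N (packet lam t gL) - rightProj N (packet lam t gR) with hr
  have h0 : Tendsto (fun t => inner ℂ (packet lam t f) (r t)) atTop (𝓝 0) := by
    have h1 := (tendsto_aeval_kZero_packet N lam βL βR p g).norm.const_mul ‖fourierSeq f‖
    rw [norm_zero, mul_zero] at h1
    refine squeeze_zero_norm (fun t => ?_) h1
    exact (norm_inner_le_norm _ _).trans (by rw [norm_packet])
  have h1 := tendsto_inner_packet_coordProj lam f gL (-((N : ℤ) + 1))
  have h2 := (tendsto_const_nhds (x := inner ℂ (fourierSeq f) (fourierSeq gR))).sub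
    (tendsto_inner_packet_coordProj lam f gR N)
  convert (h0.add h1).add h2 using 1
  · funext t
    rw [← inner_packet lam t f gR, ← inner_sub_right, ← hR, ← inner_add_right, ← inner_add_right]
    congr 1
    simp only [hr]
    abel
  · have hint : ∀ G : C(Torus, ℂ), Integrable G haar := fun G =>
      (map_continuous G).integrable_of_hasCompactSupport (HasCompactSupport.of_compactSpace _)
    have hint2 : ∀ G : C(Torus, ℂ),
        Integrable (fun k => leftMovers k * (G k * (starRingEnd ℂ) (f k))) haar := fun G => by
      refine (hint (G * star f)).bdd_mul (c := 1)
        (measurable_const.indicator measurableSet_leftMovers).aestronglyMeasurable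
        (.of_forall fun k => ?_)
      unfold leftMovers
      by_cases h : k ∈ {k : Torus | 0 ≤ (k.toCircle : ℂ).im} <;> simp [h]
    have hint3 : Integrable (fun k => gR k * (starRingEnd ℂ) (f k)) haar := hint (gR * star f)
    have hint4 : Integrable (fun k => gR k * (starRingEnd ℂ) (f k) -
        leftMovers k * (gR k * (starRingEnd ℂ) (f k))) haar := hint3.sub (hint2 gR)
    rw [inner_fourierSeq, zero_add, ← integral_sub hint3 (hint2 gR),
      ← integral_add (hint2 gL) hint4]
    congr 1
    refine integral_congr_ae (.of_forall fun k => ?_)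
    simp only [hgL, hgR, ContinuousMap.mul_apply, leftMovers, Set.indicator_apply,
      Set.mem_ofPred_eq]
    split_ifs <;> ring

/-! ### The asymptotic two-point function -/

/-- The function `x ↦ (1 + e^{-x})⁻¹`. -/
def fermi (x : ℝ) : ℝ := (1 + Real.exp (-x))⁻¹

theorem continuous_fermi : Continuous fermi :=
  Continuous.inv₀ (by fun_prop) fun x => (by positivity)

theorem inverse_one_add_exp_neg {H : Type*} [NormedAddCommGroup H] [InnerProductSpace ℂ H]
    [CompleteSpace H] (k : H →L[ℂ] H) (hk : IsSelfAdjoint k) :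
    Ring.inverse (1 + NormedSpace.exp (-k)) = cfc fermi k := by
  have h1 : cfc (fun x : ℝ => Real.exp (-x)) k = NormedSpace.exp (-k) := by
    rw [cfc_comp_neg Real.exp k, CFC.real_exp_eq_normedSpace_exp]
  unfold fermi
  rw [cfc_inv (fun x : ℝ => 1 + Real.exp (-x)) k (fun x _ => by positivity),
    cfc_const_add (1 : ℝ) (fun x : ℝ => Real.exp (-x)) k, h1, map_one]

/-- Polynomials that approximate `x ↦ (1 + e^{-x})⁻¹` on an interval around the spectrum of `k`
approximate `(1 + e^{-k})⁻¹` in norm. -/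
theorem norm_inverse_one_add_exp_neg_sub_aeval_le {H : Type*} [NormedAddCommGroup H]
    [InnerProductSpace ℂ H] [CompleteSpace H] (k : H →L[ℂ] H) (hk : IsSelfAdjoint k)
    {R ε : ℝ} (hR : ‖k‖ ≤ R) (hε : 0 ≤ ε) {p : ℝ[X]}
    (hp : ∀ x ∈ Set.Icc (-R) R, |p.eval x - fermi x| ≤ ε) :
    ‖Ring.inverse (1 + NormedSpace.exp (-k)) - aeval k p‖ ≤ ε := by
  rcases subsingleton_or_nontrivial (H →L[ℂ] H) with hs | hs
  · rw [Subsingleton.elim (_ - _) (0 : H →L[ℂ] H), norm_zero]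
    exact hε
  rw [inverse_one_add_exp_neg k hk, ← cfc_polynomial p k hk,
    ← cfc_sub fermi p.eval k continuous_fermi.continuousOn p.continuous.continuousOn]
  refine norm_cfc_le hε fun x hx => ?_
  have h1 : |x| ≤ R := (spectrum.norm_le_norm_of_mem hx).trans hR
  rw [Real.norm_eq_abs, abs_sub_comm]
  exact hp x (abs_le.1 h1)

theorem isSelfAdjoint_coordProj (X : Set ℤ) [DecidablePred (· ∈ X)] :
    IsSelfAdjoint (coordProj X) := by
  rw [ContinuousLinearMap.isSelfAdjoint_iff_isSymmetric]
  intro f g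
  show inner ℂ (coordProj X f) g = inner ℂ f (coordProj X g)
  rw [lp.inner_eq_tsum, lp.inner_eq_tsum]
  refine tsum_congr fun x => ?_
  rw [coordProj_apply, coordProj_apply]
  split_ifs <;> simp

theorem isSelfAdjoint_ham (lam : ℝ) : IsSelfAdjoint (ham lam) := by
  rw [IsSelfAdjoint, ham, star_add, star_smul, star_smul, star_add, star_star, star_one, add_comm
    (star shift)]
  simp

theorem isSelfAdjoint_kZero (N : ℕ) (lam βL βR : ℝ) : IsSelfAdjoint (kZero N lam βL βR) := by
  have h : ∀ (β : ℝ) (X : Set ℤ) [DecidablePred (· ∈ X)],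
      IsSelfAdjoint ((β : ℂ) • (coordProj X * ham lam * coordProj X)) := fun β X _ => by
    rw [IsSelfAdjoint, star_smul, star_mul, star_mul, (isSelfAdjoint_coordProj X).star_eq,
      (isSelfAdjoint_ham lam).star_eq, mul_assoc]
    simp
  exact (h _ _).add (h _ _)

theorem aeval_energy_apply (lam β : ℝ) (p : ℝ[X]) (k : Torus) :
    aeval ((β : ℂ) • energy lam) p k = ((p.eval (β * (lam + (k.toCircle : ℂ).re)) : ℝ) : ℂ) := by
  induction p using Polynomial.induction_on with
  | C a => simp [Algebra.algebraMap_eq_smul_one]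
  | add p q hp hq =>
    rw [map_add, ContinuousMap.add_apply, hp, hq, eval_add, Complex.ofReal_add]
  | monomial n a h =>
    rw [pow_succ, ← mul_assoc, map_mul, ContinuousMap.mul_apply, h, aeval_X,
      ContinuousMap.smul_apply, energy_apply, eval_mul_X, smul_eq_mul, ← Complex.ofReal_mul,
      ← Complex.ofReal_mul]

/-- Since `½ (1 + tanh(x / 2)) = (1 + e^{-x})⁻¹` and `β ∓ δ` is `β_L` or `β_R`, the symbol assigns
the inverse temperature of the left reservoir to `sin k ≥ 0` and that of the right reservoir to
`sin k < 0`. -/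
theorem sHatMinus_eq_fermi (lam βL βR : ℝ) (z : Circle) :
    sHatMinus lam βL βR z = ((fermi ((if 0 ≤ (z : ℂ).im then βL else βR) *
      (lam + (z : ℂ).re)) : ℝ) : ℂ) := by
  have key : ∀ x : ℝ, (1 / 2) * (1 + Real.tanh ((1 / 2) * x)) = fermi x := fun x => by
    have h1 : Real.exp (-x) = Real.exp (-(1 / 2 * x)) * Real.exp (-(1 / 2 * x)) := by
      rw [← Real.exp_add]; congr 1; ring
    have h2 : Real.exp (1 / 2 * x) * Real.exp (-(1 / 2 * x)) = 1 := by
      rw [← Real.exp_add]; simp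
    rw [fermi, Real.tanh_eq_sinh_div_cosh, Real.sinh_eq, Real.cosh_eq, h1]
    set a := Real.exp (1 / 2 * x)
    set b := Real.exp (-(1 / 2 * x))
    have ha : 0 < a := Real.exp_pos _
    have hb : 0 < b := Real.exp_pos _
    have h3 : a + b ≠ 0 := by positivity
    have h4 : 1 + b * b ≠ 0 := by positivity
    field_simp
    linear_combination (2 * b) * h2
  rw [sHatMinus, rhoMinus, ← key, mul_assoc (1 / 2 : ℝ)]
  congr 6
  rw [sgn]
  split_ifs <;> ring

/-- The symbol `ŝ₋` as a function on momentum space. -/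
def torusSymbol (lam βL βR : ℝ) (k : Torus) : ℂ := sHatMinus lam βL βR k.toCircle

theorem fermi_mem_Icc (x : ℝ) : fermi x ∈ Set.Icc (0 : ℝ) 1 := by
  unfold fermi
  refine ⟨by positivity, inv_le_one_of_one_le₀ ?_⟩
  linarith [Real.exp_pos (-x)]

theorem memLp_torusSymbol (lam βL βR : ℝ) : MemLp (torusSymbol lam βL βR) ⊤ haar := by
  refine memLp_top_of_bound ?_ 1 (.of_forall fun k => ?_)
  · have hre : Measurable fun k : Torus => (k.toCircle : ℂ).re :=
      (Complex.continuous_re.comp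
        (continuous_subtype_val.comp AddCircle.continuous_toCircle)).measurable
    have h : Measurable (torusSymbol lam βL βR) := by
      unfold torusSymbol
      simp only [sHatMinus_eq_fermi]
      refine Complex.measurable_ofReal.comp (continuous_fermi.measurable.comp ?_)
      exact (Measurable.ite measurableSet_leftMovers measurable_const measurable_const).mul
        (hre.const_add _)
    exact h.aestronglyMeasurable
  · rw [torusSymbol, sHatMinus_eq_fermi, Complex.norm_real, Real.norm_eq_abs,
      abs_of_nonneg (fermi_mem_Icc _).1]
    exact (fermi_mem_Icc _).2

theorem norm_kron {ι : Type} [DecidableEq ι] (i : ι) : ‖kron i‖ = 1 := by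
  simp [kron, lp.norm_single]

theorem norm_fourier_apply (n : ℤ) (k : Torus) : ‖fourier n k‖ = 1 := by
  rw [fourier_apply, Circle.norm_coe]

/-- The wave packet that starts at the site `x`. -/
theorem exp_ham_kron (lam t : ℝ) (x : ℤ) :
    NormedSpace.exp ((Complex.I * t) • ham lam) (kron x) = packet lam t (fourier x) := by
  rw [← fourierSeq_fourier, exp_ham_fourierSeq]

theorem memLp_ite_leftMovers (G H : C(Torus, ℂ)) :
    MemLp (fun k : Torus => if 0 ≤ (k.toCircle : ℂ).im then G k else H k) ⊤ haar := by
  refine memLp_top_of_bound (Measurable.ite measurableSet_leftMovers (map_continuous G).measurable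
    (map_continuous H).measurable).aestronglyMeasurable (‖G‖ + ‖H‖) (.of_forall fun k => ?_)
  split_ifs
  · exact (G.norm_coe_le_norm k).trans (le_add_of_nonneg_right (norm_nonneg _))
  · exact (H.norm_coe_le_norm k).trans (le_add_of_nonneg_left (norm_nonneg _))

theorem dist_integral_mul_le {s s' : Torus → ℂ} (hs : MemLp s ⊤ haar) (hs' : MemLp s' ⊤ haar)
    {ε : ℝ} (hε : ∀ k, ‖s k - s' k‖ ≤ ε) (w : C(Torus, ℂ)) (hw : ∀ k, ‖w k‖ ≤ 1) :
    dist (∫ k, s k * w k ∂haar) (∫ k, s' k * w k ∂haar) ≤ ε := by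
  have hint : ∀ r : Torus → ℂ, MemLp r ⊤ haar → Integrable (fun k => r k * w k) haar :=
    fun r hr => ((hr.mono_exponent le_top).integrable le_rfl).mul_bdd
      (map_continuous w).aestronglyMeasurable (.of_forall hw)
  rw [dist_eq_norm, ← integral_sub (hint s hs) (hint s' hs')]
  refine (norm_integral_le_of_norm_le_const (C := ε) (.of_forall fun k => ?_)).trans (by simp)
  rw [← sub_mul, norm_mul]
  exact (mul_le_of_le_one_right (norm_nonneg _) (hw k)).trans (hε k)

/-- The two-point function of the initial state converges to the Fourier coefficients of the
symbol: the function `x ↦ (1 + e^{-x})⁻¹` is approximated by polynomials, uniformly on an interval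
that contains the spectrum of `k₀` and the ranges of `β_L (λ + cos k)` and `β_R (λ + cos k)`. -/
theorem tendsto_twoPoint (N : ℕ) (lam βL βR : ℝ) (i j : ℤ) :
    Tendsto (fun t : ℝ => inner ℂ (NormedSpace.exp ((Complex.I * t) • ham lam) (kron i))
      (Ring.inverse (1 + NormedSpace.exp (-kZero N lam βL βR))
        (NormedSpace.exp ((Complex.I * t) • ham lam) (kron j)))) atTop
      (𝓝 (fourierCoeff (torusSymbol lam βL βR) (i - j))) := by
  have hsa := isSelfAdjoint_kZero N lam βL βR
  have hlim : fourierCoeff (torusSymbol lam βL βR) (i - j) = ∫ k, torusSymbol lam βL βR k *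
      ((fourier j : C(Torus, ℂ)) k * (starRingEnd ℂ) ((fourier i : C(Torus, ℂ)) k)) ∂haar := by
    rw [← laurent_kron_apply _ (memLp_torusSymbol lam βL βR), ← inner_kron_left,
      ← fourierSeq_fourier, ← fourierSeq_fourier, inner_laurent]
  obtain ⟨w, hw⟩ : ∃ w : C(Torus, ℂ), ∀ k, w k =
      (fourier j : C(Torus, ℂ)) k * (starRingEnd ℂ) ((fourier i : C(Torus, ℂ)) k) :=
    ⟨fourier j * star (fourier i), fun _ => rfl⟩
  simp only [← hw] at hlim
  simp only [exp_ham_kron]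
  rw [hlim, Metric.tendsto_atTop]
  intro ε hε
  set R : ℝ := max ‖kZero N lam βL βR‖ (max (|βL| * (|lam| + 1)) (|βR| * (|lam| + 1))) with hR
  obtain ⟨p, hp⟩ := exists_polynomial_near_of_continuousOn (-R) R fermi
    continuous_fermi.continuousOn (ε / 3) (by positivity)
  have hp' : ∀ x ∈ Set.Icc (-R) R, |p.eval x - fermi x| ≤ ε / 3 := fun x hx => (hp x hx).le
  have hop := norm_inverse_one_add_exp_neg_sub_aeval_le (kZero N lam βL βR) hsa (le_max_left _ _)
    (by positivity) hp'
  have hconv := tendsto_inner_aeval_kZero N lam βL βR p (fourier i) (fourier j)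
  simp only [← hw] at hconv
  rw [Metric.tendsto_atTop] at hconv
  obtain ⟨t₀, ht₀⟩ := hconv (ε / 3) (by positivity)
  refine ⟨t₀, fun t ht => ?_⟩
  have h1 := ht₀ t ht
  have h2 : dist (inner ℂ (packet lam t (fourier i))
      (Ring.inverse (1 + NormedSpace.exp (-kZero N lam βL βR)) (packet lam t (fourier j))))
      (inner ℂ (packet lam t (fourier i))
        (aeval (kZero N lam βL βR) p (packet lam t (fourier j)))) ≤ ε / 3 := by
    rw [dist_eq_norm, ← inner_sub_right, ← sub_apply]
    refine (norm_inner_le_norm _ _).trans ?_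
    have hn : ∀ x : ℤ, ‖packet lam t (fourier x)‖ = 1 := fun x => by
      rw [norm_packet, fourierSeq_fourier, norm_kron]
    rw [hn, one_mul]
    refine (ContinuousLinearMap.le_opNorm _ _).trans ?_
    rw [hn, mul_one]
    exact hop
  have hbound : ∀ (β : ℝ), |β| * (|lam| + 1) ≤ R → ∀ k : Torus,
      β * (lam + (k.toCircle : ℂ).re) ∈ Set.Icc (-R) R := fun β hβ k => by
    rw [Set.mem_Icc, ← abs_le, abs_mul]
    refine le_trans (mul_le_mul_of_nonneg_left ?_ (abs_nonneg _)) hβ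
    refine (abs_add_le _ _).trans (add_le_add_right ?_ _)
    exact (Complex.abs_re_le_norm _).trans (Circle.norm_coe _).le
  have hL := hbound βL ((le_max_left _ _).trans (le_max_right _ _))
  have hR' := hbound βR ((le_max_right _ _).trans (le_max_right _ _))
  have h3 := dist_integral_mul_le (ε := ε / 3)
    (memLp_ite_leftMovers (aeval ((βL : ℂ) • energy lam) p) (aeval ((βR : ℂ) • energy lam) p))
    (memLp_torusSymbol lam βL βR) (fun k => by
      rw [torusSymbol, sHatMinus_eq_fermi, aeval_energy_apply, aeval_energy_apply]
      split_ifs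
      · rw [← Complex.ofReal_sub, Complex.norm_real]; exact hp' _ (hL k)
      · rw [← Complex.ofReal_sub, Complex.norm_real]; exact hp' _ (hR' k)) w (fun k => by
      rw [hw, norm_mul, RCLike.norm_conj, norm_fourier_apply, norm_fourier_apply, one_mul])
  have h12 := lt_of_le_of_lt (dist_triangle _ _ _) (add_lt_add_of_le_of_lt h2 h1)
  have h123 := lt_of_le_of_lt (dist_triangle _ _ _) (add_lt_add_of_lt_of_le h12 h3)
  exact h123.trans_eq (by ring)

/-! ### The Toeplitz operator -/

theorem symbolCoeff_sHatMinus (lam βL βR : ℝ) (x : ℤ) :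
    symbolCoeff (sHatMinus lam βL βR) x = fourierCoeff (torusSymbol lam βL βR) x := by
  have h := fourierCoeff_eq_intervalIntegral (torusSymbol lam βL βR) x (-Real.pi)
  rw [h, symbolCoeff, show -Real.pi + 2 * Real.pi = Real.pi by ring, Complex.real_smul]
  congr 1
  · push_cast; rw [one_div]
  · refine intervalIntegral.integral_congr fun k _ => ?_
    have h1 : AddCircle.toCircle (k : Torus) = Circle.exp k := by
      rw [AddCircle.toCircle_apply_mk, div_self Real.two_pi_pos.ne', one_mul]
    simp only [torusSymbol, h1, fourier_coe_real, smul_eq_mul]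
    rw [mul_comm]
    congr 2
    push_cast
    ring

/-- The extension of a sequence on `ℕ` by zero to `ℤ`. -/
def extendZero : L2 ℕ →L[ℂ] OneParticle :=
  wcomp (fun x : ℤ => if 0 ≤ x then 1 else 0) Int.toNat
    (fun x => by split_ifs <;> simp) (fun x y hx hy h => by
      have hx' : 0 ≤ x := by by_contra h'; simp [h'] at hx
      have hy' : 0 ≤ y := by by_contra h'; simp [h'] at hy
      omega)

/-- The restriction of a sequence on `ℤ` to `ℕ`. -/
def restrictNat : OneParticle →L[ℂ] L2 ℕ :=
  wcomp (fun _ => 1) (fun i : ℕ => (i : ℤ)) (by simp) (fun i j _ _ h => by exact_mod_cast h)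

theorem extendZero_kron (j : ℕ) : extendZero (kron j) = kron (j : ℤ) := by
  apply lp.ext
  funext x
  simp only [extendZero, wcomp_apply, kron_apply]
  split_ifs <;> first | omega | simp

theorem restrictNat_apply (f : OneParticle) (i : ℕ) : restrictNat f i = f i := by
  simp [restrictNat]

/-- The Toeplitz operator: the compression of the Laurent operator to `ℓ²(ℕ)`. -/
def toeplitz (s : Torus → ℂ) (hs : MemLp s ⊤ haar) : L2 ℕ →L[ℂ] L2 ℕ :=
  restrictNat ∘L laurent s hs ∘L extendZero

theorem toeplitz_kron_apply (s : Torus → ℂ) (hs : MemLp s ⊤ haar) (i j : ℕ) :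
    toeplitz s hs (kron j) i = fourierCoeff s ((i : ℤ) - j) := by
  show restrictNat (laurent s hs (extendZero (kron j))) i = _
  rw [restrictNat_apply, extendZero_kron, laurent_kron_apply]

theorem hasSum_smul_kron {ι : Type} [DecidableEq ι] (f : L2 ι) :
    HasSum (fun i => f i • kron i) f := by
  refine (lp.hasSum_single (by norm_num) f).congr_fun fun i => ?_
  rw [kron, ← lp.single_smul, smul_eq_mul, mul_one]

theorem isToeplitzOperator_toeplitz (lam βL βR : ℝ) :
    IsToeplitzOperator (sHatMinus lam βL βR)
      (toeplitz (torusSymbol lam βL βR) (memLp_torusSymbol lam βL βR)) := by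
  intro f i
  have h := ((hasSum_smul_kron f).mapL
    (toeplitz (torusSymbol lam βL βR) (memLp_torusSymbol lam βL βR))).mapL
      (innerSL ℂ (kron i : L2 ℕ))
  simp only [innerSL_apply_apply, inner_kron_left] at h
  refine h.congr_fun fun j => ?_
  rw [map_smul, lp.coeFn_smul, Pi.smul_apply, toeplitz_kron_apply, symbolCoeff_sHatMinus,
    smul_eq_mul, mul_comm]

/-! ### The time evolution of the two-point function -/

/-- The embedding `f ↦ [f, 0]`. -/
def pairLeft : OneParticle →L[ℂ] Doubled :=
  ((WithLp.prodContinuousLinearEquiv 2 ℂ OneParticle OneParticle).symm :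
      OneParticle × OneParticle →L[ℂ] Doubled) ∘L ContinuousLinearMap.inl ℂ OneParticle OneParticle

/-- The embedding `f ↦ [0, f]`. -/
def pairRight : OneParticle →L[ℂ] Doubled :=
  ((WithLp.prodContinuousLinearEquiv 2 ℂ OneParticle OneParticle).symm :
      OneParticle × OneParticle →L[ℂ] Doubled) ∘L ContinuousLinearMap.inr ℂ OneParticle OneParticle

theorem pairLeft_apply (f : OneParticle) : pairLeft f = pair f 0 := rfl

theorem pairRight_apply (f : OneParticle) : pairRight f = pair 0 f := rfl

theorem exp_smul_dsum_pair_left (c : ℂ) (A D : OneParticle →L[ℂ] OneParticle) (f : OneParticle) :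
    NormedSpace.exp (c • dsum A D) (pair f 0) = pair (NormedSpace.exp (c • A) f) 0 := by
  have h := exp_apply_of_intertwines (c • dsum A D)
    (pairLeft ∘L ContinuousLinearMap.apply ℂ OneParticle f) (c • A) (fun X => by
      show c • dsum A D (pair (X f) 0) = pairLeft (c • A (X f))
      rw [dsum_pair, map_zero, map_smul, pairLeft_apply]) 1
  rw [mul_one] at h
  exact h

theorem exp_smul_dsum_pair_right (c : ℂ) (A D : OneParticle →L[ℂ] OneParticle)
    (f : OneParticle) :
    NormedSpace.exp (c • dsum A D) (pair 0 f) = pair 0 (NormedSpace.exp (c • D) f) := by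
  have h := exp_apply_of_intertwines (c • dsum A D)
    (pairRight ∘L ContinuousLinearMap.apply ℂ OneParticle f) (c • D) (fun X => by
      show c • dsum A D (pair 0 (X f)) = pairRight (c • D (X f))
      rw [dsum_pair, map_zero, map_smul, pairRight_apply]) 1
  rw [mul_one] at h
  exact h

theorem inner_pair (f₁ f₂ g₁ g₂ : OneParticle) :
    inner ℂ (pair f₁ f₂) (pair g₁ g₂) = inner ℂ f₁ g₁ + inner ℂ f₂ g₂ := by
  rw [WithLp.prod_inner_apply]; rfl

section Evolution

variable {N : ℕ} {lam βL βR : ℝ} {τ : ℝ → CAR ≃⋆ₐ[ℂ] CAR} {ω₀ : CAR →ₗ[ℂ] ℂ}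

/-- The two-point matrix of the initial state at time `t` on the sites `1, …, n`. -/
def twoPointMatrix (N : ℕ) (lam βL βR : ℝ) (n : ℕ) (t : ℝ) : Matrix (Fin n) (Fin n) ℂ :=
  Matrix.of fun i j =>
    inner ℂ (NormedSpace.exp ((Complex.I * t) • ham lam) (kron ((i : ℤ) + 1)))
      (Ring.inverse (1 + NormedSpace.exp (-kZero N lam βL βR))
        (NormedSpace.exp ((Complex.I * t) • ham lam) (kron ((j : ℤ) + 1))))

theorem evolve_star_annihGen (hτ : IsDynamics lam τ) (t : ℝ) (x : ℤ) :
    τ t (star (annihGen x)) =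
      B (pair (NormedSpace.exp ((Complex.I * t) • ham lam) (kron x)) 0) := by
  rw [star_annihGen, hτ, exp_smul_dsum_pair_left]

theorem evolve_annihGen (hτ : IsDynamics lam τ) (t : ℝ) (x : ℤ) :
    τ t (annihGen x) =
      B (pair 0 (NormedSpace.exp ((Complex.I * t) • -ham lam) (kron x))) := by
  rw [annihGen, hτ, exp_smul_dsum_pair_right]

/-- Both factors are expressed by creation operators, so that the conjugation in `J` does not
appear. -/
theorem initial_annihGen_mul_star (hτ : IsDynamics lam τ)
    (hω₀ : IsInitialState N lam βL βR ω₀) (t : ℝ) (x y : ℤ) :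
    ω₀ (τ t (annihGen x) * τ t (star (annihGen y))) =
      inner ℂ (NormedSpace.exp ((Complex.I * t) • ham lam) (kron x))
        (Ring.inverse (1 + NormedSpace.exp (-kZero N lam βL βR))
          (NormedSpace.exp ((Complex.I * t) • ham lam) (kron y))) := by
  rw [← star_star (annihGen x), map_star, evolve_star_annihGen hτ,
    evolve_star_annihGen hτ, hω₀.2.2.2.2, initialDensity, dsum_pair, inner_pair, inner_zero_left,
    add_zero]

theorem initial_annihGen_mul_annihGen (hτ : IsDynamics lam τ)
    (hω₀ : IsInitialState N lam βL βR ω₀) (t : ℝ) (x y : ℤ) :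
    ω₀ (τ t (annihGen x) * τ t (annihGen y)) = 0 := by
  rw [← star_star (annihGen x), map_star, evolve_star_annihGen hτ, evolve_annihGen hτ,
    hω₀.2.2.2.2, initialDensity, dsum_pair, inner_pair, inner_zero_left, add_zero, map_zero,
    inner_zero_right]

theorem initial_star_mul_star (hτ : IsDynamics lam τ)
    (hω₀ : IsInitialState N lam βL βR ω₀) (t : ℝ) (x y : ℤ) :
    ω₀ (τ t (star (annihGen x)) * τ t (star (annihGen y))) = 0 := by
  rw [map_star, evolve_annihGen hτ, evolve_star_annihGen hτ,
    hω₀.2.2.2.2, initialDensity, dsum_pair, inner_pair, inner_zero_left, zero_add, map_zero,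
    inner_zero_right]

/-- In the nested order of the form factors, quasifreeness yields a Pfaffian whose index set is the
union of two isotropic halves. -/
theorem exists_sign_initial_efp (hτ : IsDynamics lam τ) (hω₀ : IsInitialState N lam βL βR ω₀)
    (n : ℕ) (t : ℝ) :
    ∃ c : ℤˣ, ω₀ (τ t (efpObservable n)) =
      ((c : ℤ) : ℂ) * (twoPointMatrix N lam βL βR n t).det := by
  set F : Fin (2 * n) → Doubled := fun i =>
    NormedSpace.exp ((Complex.I * t) • dsum (ham lam) (-ham lam)) (nestedFactor n i) with hF
  have hBF : ∀ i, B (F i) = τ t (B (nestedFactor n i)) := fun i => (hτ t _).symm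
  have h1 : τ t (efpObservable n) = fieldProd F := by
    rw [efpObservable_eq_fieldProd_nested, fieldProd, fieldProd, map_list_prod, List.map_ofFn]
    congr 2
    funext i
    exact (hBF i).symm
  have hlo : ∀ i : Fin (2 * n), (i : ℕ) < n → B (F i) = τ t (annihGen (i + 1)) := fun i hi => by
    rw [hBF, nestedFactor, if_pos hi, annihGen]
  have hhi : ∀ i : Fin (2 * n), n ≤ (i : ℕ) →
      B (F i) = τ t (star (annihGen ((2 * n - i : ℕ) : ℤ))) := fun i hi => by
    rw [hBF, nestedFactor, if_neg (by omega), star_annihGen]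
  obtain ⟨c, hc⟩ := exists_sign_pf_eq_det (corrMatrix ω₀ F)
    (fun i j hij hj => by
      rw [corrMatrix, Matrix.of_apply, if_pos hij, hlo i (lt_trans hij hj), hlo j hj,
        initial_annihGen_mul_annihGen hτ hω₀])
    (fun i j hij hi => by
      rw [corrMatrix, Matrix.of_apply, if_pos hij, hhi i hi, hhi j (hi.trans (le_of_lt hij)),
        initial_star_mul_star hτ hω₀])
  refine ⟨c, ?_⟩
  rw [h1, hω₀.1.2.2, hc]
  congr 2
  ext i j
  have hij : (⟨i, by omega⟩ : Fin (2 * n)) < ⟨2 * n - 1 - j, by omega⟩ := by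
    rw [Fin.mk_lt_mk]; omega
  have hj : ((2 * n - (2 * n - 1 - (j : ℕ)) : ℕ) : ℤ) = j + 1 := by omega
  rw [Matrix.of_apply, corrMatrix, Matrix.of_apply, if_pos hij, hlo _ i.2,
    hhi _ (by simp only; omega), initial_annihGen_mul_star hτ hω₀, twoPointMatrix, Matrix.of_apply,
    hj]

theorem posSemidef_twoPointMatrix (hω₀ : IsInitialState N lam βL βR ω₀) (n : ℕ) (t : ℝ) :
    (twoPointMatrix N lam βL βR n t).PosSemidef := by
  set s₀ := Ring.inverse (1 + NormedSpace.exp (-kZero N lam βL βR)) with hs₀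
  set ψ : Fin n → OneParticle := fun i =>
    NormedSpace.exp ((Complex.I * t) • ham lam) (kron ((i : ℤ) + 1)) with hψ
  have hS : ∀ f g : OneParticle, inner ℂ f (s₀ g) =
      inner ℂ (pair f 0) (initialDensity N lam βL βR (pair g 0)) := fun f g => by
    rw [initialDensity, dsum_pair, inner_pair, inner_zero_left, add_zero]
  have hpos := hω₀.2.1
  have hsymm : ∀ f g : OneParticle, inner ℂ (s₀ f) g = inner ℂ f (s₀ g) := fun f g => by
    rw [← inner_conj_symm, hS, hS, inner_conj_symm]
    exact hpos.isSymmetric _ _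
  refine Matrix.PosSemidef.of_dotProduct_mulVec_nonneg ?_ fun v => ?_
  · ext i j
    show star (inner ℂ (ψ j) (s₀ (ψ i))) = inner ℂ (ψ i) (s₀ (ψ j))
    rw [← hsymm (ψ i) (ψ j)]
    exact inner_conj_symm _ _
  · have h : star v ⬝ᵥ (twoPointMatrix N lam βL βR n t).mulVec v =
        inner ℂ (∑ i, v i • ψ i) (s₀ (∑ i, v i • ψ i)) := by
      simp only [map_sum, sum_inner, inner_sum, map_smul, inner_smul_left, inner_smul_right,
        dotProduct, Matrix.mulVec, Finset.mul_sum]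
      rw [Finset.sum_comm]
      refine Finset.sum_congr rfl fun j _ => Finset.sum_congr rfl fun i _ => ?_
      show star (v i) * (inner ℂ (ψ i) (s₀ (ψ j)) * v j) =
        v j * (star (v i) * inner ℂ (ψ i) (s₀ (ψ j)))
      ring
    rw [h, hS]
    exact hpos.inner_nonneg_right _

theorem state_apply_isStarProjection {ω : CAR →ₗ[ℂ] ℂ} (hω : IsState ω) {P : CAR}
    (hP : IsStarProjection P) : ∃ p ∈ Set.Icc (0 : ℝ) 1, ω P = (p : ℂ) := by
  have h : ∀ Q : CAR, IsStarProjection Q → 0 ≤ ω Q := fun Q hQ => by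
    have := hω.2 Q
    rwa [hQ.isSelfAdjoint.star_eq, hQ.isIdempotentElem.eq] at this
  have h0 := Complex.le_def.1 (h P hP)
  have h1 := Complex.le_def.1 (h _ hP.one_sub)
  rw [map_sub, hω.1, Complex.sub_re, Complex.one_re, Complex.zero_re, sub_nonneg] at h1
  exact ⟨(ω P).re, ⟨h0.1, h1.1⟩, Complex.ext rfl h0.2.symm⟩

/-- The sign of the Pfaffian need not be computed: the expectation of a projection and the
determinant of a positive semidefinite matrix are both nonnegative. -/
theorem initial_efp_eq_det (hτ : IsDynamics lam τ) (hω₀ : IsInitialState N lam βL βR ω₀)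
    (n : ℕ) (t : ℝ) :
    ω₀ (τ t (efpObservable n)) = (twoPointMatrix N lam βL βR n t).det := by
  obtain ⟨c, hc⟩ := exists_sign_initial_efp hτ hω₀ n t
  obtain ⟨p, hp, h1⟩ := state_apply_isStarProjection hω₀.1.1
    ((isStarProjection_efpObservable n).map (τ t))
  have h2 := (posSemidef_twoPointMatrix hω₀ n t).det_nonneg
  rcases Int.units_eq_one_or c with rfl | rfl
  · simpa using hc
  · simp only [Units.val_neg, Units.val_one, Int.cast_neg, Int.cast_one, neg_mul, one_mul] at hc
    have h3 : 0 ≤ ω₀ (τ t (efpObservable n)) := by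
      rw [h1]; exact_mod_cast hp.1
    rw [hc, neg_nonneg] at h3
    rw [hc, le_antisymm h3 h2, neg_zero]

theorem continuous_det_twoPointMatrix (N : ℕ) (lam βL βR : ℝ) (n : ℕ) :
    Continuous fun t => (twoPointMatrix N lam βL βR n t).det := by
  refine Continuous.matrix_det (continuous_matrix fun i j => ?_)
  have h : ∀ x : ℤ, Continuous fun t : ℝ =>
      NormedSpace.exp ((Complex.I * t) • ham lam) (kron x) := fun x => by
    let _ : NormedAlgebra ℚ (OneParticle →L[ℂ] OneParticle) :=
      NormedAlgebra.restrictScalars ℚ ℂ _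
    exact (NormedSpace.exp_continuous.comp (by fun_prop)).clm_apply continuous_const
  exact (h _).inner ((ContinuousLinearMap.continuous _).comp (h _))

theorem tendsto_det_twoPointMatrix (N : ℕ) (lam βL βR : ℝ) (n : ℕ) :
    Tendsto (fun t => (twoPointMatrix N lam βL βR n t).det) atTop
      (𝓝 (finiteSection n (toeplitz (torusSymbol lam βL βR)
        (memLp_torusSymbol lam βL βR))).det) := by
  refine ((continuous_id.matrix_det).tendsto _).comp ?_
  refine tendsto_pi_nhds.2 fun i => tendsto_pi_nhds.2 fun j => ?_
  have h := tendsto_twoPoint N lam βL βR ((i : ℤ) + 1) ((j : ℤ) + 1)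
  have e : (id (finiteSection n (toeplitz (torusSymbol lam βL βR)
      (memLp_torusSymbol lam βL βR)))) i j =
      fourierCoeff (torusSymbol lam βL βR) ((i : ℤ) + 1 - (j + 1)) := by
    rw [id, finiteSection, Matrix.of_apply, inner_kron_left, toeplitz_kron_apply,
      add_sub_add_right_eq_sub]
  rw [← e] at h
  exact h

end Evolution

/-! ### Time averages -/

/-- After the substitution `t = T s` the mean is an integral over `[0, 1]`, which converges by
dominated convergence. -/
theorem tendsto_average_of_tendsto {g : ℝ → ℂ} {l : ℂ} {C : ℝ} (hg : Continuous g)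
    (hC : ∀ t, ‖g t‖ ≤ C) (h : Tendsto g atTop (𝓝 l)) :
    Tendsto (fun T : ℝ => (T : ℂ)⁻¹ * ∫ t in (0 : ℝ)..T, g t) atTop (𝓝 l) := by
  have h1 : Tendsto (fun T : ℝ => ∫ s in (0 : ℝ)..1, g (T * s)) atTop
      (𝓝 (∫ _s in (0 : ℝ)..1, l)) := by
    refine intervalIntegral.tendsto_integral_filter_of_dominated_convergence (fun _ => C)
      (.of_forall fun T => (by fun_prop : Continuous fun s => g (T * s)).aestronglyMeasurable)
      (.of_forall fun T => .of_forall fun s _ => hC _) intervalIntegrable_const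
      (.of_forall fun s hs => ?_)
    rw [Set.uIoc_of_le zero_le_one] at hs
    exact h.comp (tendsto_id.atTop_mul_const hs.1)
  rw [intervalIntegral.integral_const, sub_zero, one_smul] at h1
  refine h1.congr' ?_
  filter_upwards [eventually_ne_atTop 0] with T hT
  rw [intervalIntegral.integral_comp_mul_left _ hT, mul_zero, mul_one, Complex.real_smul,
    Complex.ofReal_inv]

end XYChain

end

open XYChain
theorem mainTheorem2 (N : ℕ) (lam βL βR : ℝ) (hβL : 0 < βL) (hβ : βL ≤ βR)
    (τ : ℝ → CAR ≃⋆ₐ[ℂ] CAR) (hτ : IsDynamics lam τ)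
    (ω₀ : CAR →ₗ[ℂ] ℂ) (hω₀ : IsInitialState N lam βL βR ω₀)
    (ω : CAR →ₗ[ℂ] ℂ) (hω : IsNESS τ ω₀ ω) :
    (∀ n : ℕ, ∃ p ∈ Set.Icc (0 : ℝ) 1, ω (efpObservable n) = (p : ℂ)) ∧
    ∃ T : L2 ℕ →L[ℂ] L2 ℕ, IsToeplitzOperator (sHatMinus lam βL βR) T ∧
      ∀ n : ℕ, ω (efpObservable n) = (finiteSection n T).det := by
  refine ⟨fun n => ?_, _, isToeplitzOperator_toeplitz lam βL βR, fun n => ?_⟩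
  · exact state_apply_isStarProjection hω.1 (isStarProjection_efpObservable n)
  · have hconv : Filter.Tendsto
        (fun T : ℝ => (T : ℂ)⁻¹ * ∫ t in (0 : ℝ)..T, ω₀ (τ t (efpObservable n))) Filter.atTop
        (nhds (finiteSection n (toeplitz (torusSymbol lam βL βR)
          (memLp_torusSymbol lam βL βR))).det) := by
      have hdet : (fun t => ω₀ (τ t (efpObservable n))) =
          fun t => (twoPointMatrix N lam βL βR n t).det :=
        funext fun t => initial_efp_eq_det hτ hω₀ n t
      refine tendsto_average_of_tendsto (C := 1) ?_ (fun t => ?_) ?_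
      · rw [hdet]; exact continuous_det_twoPointMatrix N lam βL βR n
      · obtain ⟨p, hp, h1⟩ := state_apply_isStarProjection hω₀.1.1
          ((isStarProjection_efpObservable n).map (τ t))
        rw [h1, Complex.norm_real, Real.norm_eq_abs, abs_of_nonneg hp.1]
        exact hp.2
      · rw [hdet]; exact tendsto_det_twoPointMatrix N lam βL βR n
    have hclus := hω.2.continuousAt_comp (f := fun φ : CAR → ℂ => φ (efpObservable n))
      (continuous_apply _).continuousAt
    have hne : (nhds (ω (efpObservable n)) ⊓ nhds (finiteSection n (toeplitz
        (torusSymbol lam βL βR) (memLp_torusSymbol lam βL βR))).det).NeBot :=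
      Filter.NeBot.mono hclus.clusterPt (inf_le_inf_left _ hconv)
    exact eq_of_nhds_neBot hne
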